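/- Let $D=[0,1)$ and let $F:D\to D$ be given by $F(x)=2x+\frac16$ on $[0,\frac16)$, $F(x)=\frac12(x-\frac16)$ on $[\frac16,\frac12)$, $F(x)=\frac12(x-\frac12)+\frac56$ on $[\frac12,\frac56)$ and $F(x)=2(x-\frac56)+\frac12$ on $[\frac56,1)$. For $t\in S^1=\mathbb{R}/\mathbb{Z}$ let $r_t:D\to D$ be the translation by $t$ modulo $1$, and let $F_t=F\circ r_t$, a bijection of $D$. A Cantor set is a non-empty, compact, perfect, totally disconnected set, and the $\omega$-limit of $x$ under a map $f$ is $\bigcap_{n}\overline{\{f^k(x):k\ge n\}}$, with closures taken in $\mathbb{R}$. (1) There is a Cantor set $K\subset S^1$ such that for every $t\in K$ there are disjoint Cantor sets $\mathcal{C}_t,\mathcal{R}_t\subset D$ with the following properties. The set $\mathcal{C}_t$ has zero Lebesgue measure, and indeed zero $s$-dimensional Hausdorff measure for every $s>0$; the set $\mathcal{R}_t$ has zero Lebesgue measure. For every $x\in D\setminus\mathcal{R}_t$, the $\omega$-limit of $x$ under $F_t$ is equal to $\mathcal{C}_t$. The set $\mathcal{R}_t$ is the corresponding repeller: for every $x\in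 D\setminus\mathcal{C}_t$, the $\omega$-limit of $x$ under $F_t^{-1}$ is equal to $\mathcal{R}_t$. (2) The set of parameters $t\in S^1$ for which $F_t$ is completely periodic, that is, for which there is an integer $p(t)\ge 1$ with $F_t^{p(t)}=\mathrm{Id}$ on $D$, is countably infinite. -/

import Mathlib

open Set Filter Topology MeasureTheory

/-- The piecewise affine involution `F` of `D = [0, 1)`, written as a function on `ℝ`; only its
values on `[0, 1)` matter. -/
noncomputable def discoF (x : ℝ) : ℝ :=
  if x < 1 / 6 then 2 * x + 1 / 6
  else if x < 1 / 2 then (x - 1 / 6) / 2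
  else if x < 5 / 6 then (x - 1 / 2) / 2 + 5 / 6
  else 2 * (x - 5 / 6) + 1 / 2

/-- The translation `r_t` modulo `1`: the representative in `[0, 1)` of the class of `x + t`,
for `t ∈ S¹ = ℝ / ℤ`. -/
noncomputable def rot (t : UnitAddCircle) (x : ℝ) : ℝ :=
  ((AddCircle.equivIco 1 0 ((x : UnitAddCircle) + t) : Ico (0 : ℝ) (0 + 1)) : ℝ)

/-- The affine interval exchange `F_t = F ∘ r_t` of `[0, 1)`. -/
noncomputable def discoMap (t : UnitAddCircle) (x : ℝ) : ℝ := discoF (rot t x)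

/-- The inverse `F_t⁻¹ = r_{-t} ∘ F` of `F_t` on `[0, 1)`
(see `discoMapInv_discoMap` and `discoMap_discoMapInv`). -/
noncomputable def discoMapInv (t : UnitAddCircle) (x : ℝ) : ℝ := rot (-t) (discoF x)

/-- The `ω`-limit set of the point `x` under the map `f`: the intersection over `n` of the
closures (in `ℝ`) of the tails of the orbit of `x`. -/
def omegaLim (f : ℝ → ℝ) (x : ℝ) : Set ℝ :=
  omegaLimit atTop (fun (n : ℕ) (y : ℝ) => f^[n] y) {x}

/-- A Cantor set: a non-empty compact, perfect, totally disconnected set. It is used in `ℝ` and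
in the circle, where these properties characterise the sets homeomorphic to `{0, 1}^ℕ`. -/
def IsCantorSet {X : Type*} [TopologicalSpace X] (C : Set X) : Prop :=
  C.Nonempty ∧ IsCompact C ∧ Perfect C ∧ IsTotallyDisconnected C

theorem rot_mem (t : UnitAddCircle) (x : ℝ) : rot t x ∈ Ico (0 : ℝ) 1 := by
  have h := (AddCircle.equivIco 1 0 ((x : UnitAddCircle) + t)).2
  simpa [rot] using h

theorem coe_rot (t : UnitAddCircle) (x : ℝ) :
    ((rot t x : ℝ) : UnitAddCircle) = (x : UnitAddCircle) + t :=
  (AddCircle.equivIco 1 0).symm_apply_apply ((x : UnitAddCircle) + t)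

theorem rot_eq_fract (t x : ℝ) : rot (t : UnitAddCircle) x = Int.fract (x + t) := by
  have h := AddCircle.coe_equivIco_mk_apply (p := (1 : ℝ)) (x + t)
  simpa [rot] using h

theorem rot_neg_rot (t : UnitAddCircle) {x : ℝ} (hx : x ∈ Ico (0 : ℝ) 1) :
    rot (-t) (rot t x) = x := by
  induction t using QuotientAddGroup.induction_on with
  | H s =>
    have h1 : rot ((-s : ℝ) : UnitAddCircle) (rot (s : UnitAddCircle) x) = x := by
      rw [rot_eq_fract, rot_eq_fract, Int.fract_eq_iff]
      exact ⟨hx.1, hx.2, -⌊x + s⌋, by push_cast; rw [Int.fract]; ring⟩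
    simpa using h1

theorem discoF_mem {x : ℝ} (hx : x ∈ Ico (0 : ℝ) 1) : discoF x ∈ Ico (0 : ℝ) 1 := by
  obtain ⟨h0, h1⟩ := hx
  unfold discoF
  split_ifs <;> constructor <;> linarith

theorem discoF_discoF {x : ℝ} (hx : x ∈ Ico (0 : ℝ) 1) : discoF (discoF x) = x := by
  obtain ⟨h0, h1⟩ := hx
  unfold discoF
  split_ifs <;> linarith

theorem discoMap_mem (t : UnitAddCircle) (x : ℝ) : discoMap t x ∈ Ico (0 : ℝ) 1 :=
  discoF_mem (rot_mem t x)

theorem discoMapInv_discoMap (t : UnitAddCircle) {x : ℝ} (hx : x ∈ Ico (0 : ℝ) 1) :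
    discoMapInv t (discoMap t x) = x := by
  rw [discoMapInv, discoMap, discoF_discoF (rot_mem t x), rot_neg_rot t hx]

theorem discoMap_discoMapInv (t : UnitAddCircle) {x : ℝ} (hx : x ∈ Ico (0 : ℝ) 1) :
    discoMap t (discoMapInv t x) = x := by
  have h := rot_neg_rot (-t) (discoF_mem hx)
  rw [neg_neg] at h
  rw [discoMapInv, discoMap, h, discoF_discoF hx]

/-! On the arc `trappingSet`, of length 1/3, and for t = 2b/3 with 1/2 < b < 1, the translation
carries the arc into [1/6, 5/6), where `discoF` has slope 1/2 and returns it to the arc. In the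
chart `trapChart` the map becomes the contracted rotation u ↦ u/2 + b mod 1 (`discoMap_trapChart`),
so forward dynamics in the arc reduces to that map.

For irrational θ, `floorSeries` is strictly increasing, commutes with integer shifts and satisfies
`floorSeries_add`. Normalised to vanish at 0, it conjugates the rotation by θ to the contracted
rotation with b = `rotParam θ` (`rotCoding_add`). Any point lies in the closure of a jump of the
coding or on its range, and the halving contraction brings its orbit within 2^{-n} of a coded
rotation orbit (`exists_shadowing`). Since irrational rotations have dense orbits, all orbits have
the same limit set `rotAttractor θ`. The first n jumps cover it by n + 1 sets of diameter at most
2^{-n}, whence Hausdorff dimension zero.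

Time reversal is built in: F is an involution conjugating F_t⁻¹ to F_{-t}, and -t corresponds to the
rotation number 1 - θ (`rotParam_one_sub`). The repeller is therefore the F-image of the attractor
for -t. F sends the complement of the arc into the arc, so an orbit that never enters the arc has an
F-image that stays in it; followed backwards under F_{-t}, this puts the starting point in the
repeller. Finally b is continuous and injective on the irrationals of (0, 1), so an uncountable
compact set of irrational θ yields a Cantor set of parameters.

For periodicity, F_t^p(0) = αt + β with rational α > 0 on each branch, so only rational t can occur.
Conversely, t = 1/(9k) works for every k ≥ 1 by an explicit decomposition into strips
(`discoMap_iterate_eq_self`). -/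

/-! ### Floor series -/

/-- The nondecreasing jump function `y ↦ ∑ 2^{-(k+1)} ⌊y - (k+1) θ⌋`. -/
noncomputable def floorSeries (θ y : ℝ) : ℝ :=
  ∑' k : ℕ, (1 / 2 : ℝ) ^ (k + 1) * (⌊y - (k + 1) * θ⌋ : ℝ)

theorem hasSum_half_pow_succ : HasSum (fun k : ℕ => (1 / 2 : ℝ) ^ (k + 1)) 1 := by
  convert hasSum_geometric_two' 1 using 2 with k
  rw [pow_succ, one_div_pow]
  ring

theorem summable_half_pow_mul_succ : Summable fun k : ℕ => (1 / 2 : ℝ) ^ (k + 1) * ((k : ℝ) + 1) := by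
  have h : Summable fun k : ℕ => (k : ℝ) ^ 1 * (1 / 2 : ℝ) ^ k :=
    summable_pow_mul_geometric_of_norm_lt_one 1 (by norm_num)
  have h' := (summable_nat_add_iff 1).2 h
  refine h'.congr fun k => ?_
  push_cast
  ring

theorem summable_floorSeries (θ y : ℝ) :
    Summable fun k : ℕ => (1 / 2 : ℝ) ^ (k + 1) * (⌊y - (k + 1) * θ⌋ : ℝ) := by
  have h := (hasSum_half_pow_succ.summable.mul_right (|y| + 1)).add
    (summable_half_pow_mul_succ.mul_right |θ|)
  refine Summable.of_norm_bounded h fun k => ?_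
  rw [norm_mul, Real.norm_eq_abs, Real.norm_eq_abs, abs_of_pos (by positivity : (0 : ℝ) < (1 / 2) ^ (k + 1)),
    mul_assoc, ← mul_add]
  refine mul_le_mul_of_nonneg_left ?_ (by positivity)
  have h1 := Int.floor_le (y - (k + 1) * θ)
  have h2 := Int.lt_floor_add_one (y - (k + 1) * θ)
  have h3 : |((k : ℝ) + 1) * θ| = (k + 1) * |θ| := by
    rw [abs_mul, abs_of_pos (by positivity : (0 : ℝ) < k + 1)]
  have h4 := le_abs_self (((k : ℝ) + 1) * θ)
  have h5 := neg_abs_le (((k : ℝ) + 1) * θ)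
  have h6 := le_abs_self y
  have h7 := neg_abs_le y
  rw [abs_le]
  constructor <;> linarith

theorem floorSeries_add_one (θ y : ℝ) : floorSeries θ (y + 1) = floorSeries θ y + 1 := by
  have h := (summable_floorSeries θ y).hasSum.add hasSum_half_pow_succ
  rw [floorSeries, floorSeries, ← h.tsum_eq]
  congr 1 with k
  rw [show y + 1 - (k + 1) * θ = y - (k + 1) * θ + 1 by ring, Int.floor_add_one]
  push_cast
  ring

/-- The shift by θ turns term k + 1 into half of term k and exposes `⌊y⌋` as term 0. This
self-similarity is the source of the contraction by 1/2. -/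
theorem floorSeries_add (θ y : ℝ) : floorSeries θ (y + θ) = (⌊y⌋ + floorSeries θ y) / 2 := by
  rw [floorSeries, (summable_floorSeries θ (y + θ)).tsum_eq_zero_add, floorSeries, add_div,
    ← tsum_div_const]
  congr 1
  · have : y + θ - (((0 : ℕ) : ℝ) + 1) * θ = y := by push_cast; ring
    rw [this]
    ring
  · congr 1 with k
    have : y + θ - (((k + 1 : ℕ) : ℝ) + 1) * θ = y - (k + 1) * θ := by push_cast; ring
    rw [this]
    ring

/-- If no point of the first `n` jumps separates `y` from `y'`, the oscillation is at most
`2^{-n}`. -/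
theorem floorSeries_sub_le {θ y y' : ℝ} {n : ℕ} (h1 : y' ≤ y + 1)
    (hn : ∀ k < n, ⌊y - ((k : ℝ) + 1) * θ⌋ = ⌊y' - ((k : ℝ) + 1) * θ⌋) :
    floorSeries θ y' - floorSeries θ y ≤ (1 / 2) ^ n := by
  rw [floorSeries, floorSeries, ← (summable_floorSeries θ y').tsum_sub (summable_floorSeries θ y)]
  rw [← ((summable_floorSeries θ y').sub (summable_floorSeries θ y)).sum_add_tsum_nat_add n]
  rw [Finset.sum_eq_zero fun k hk => by rw [hn k (Finset.mem_range.1 hk), sub_self], zero_add]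
  have h := hasSum_half_pow_succ.mul_left ((1 / 2 : ℝ) ^ n)
  rw [mul_one] at h
  rw [← h.tsum_eq]
  refine Summable.tsum_le_tsum (fun k => ?_) ((summable_nat_add_iff n).2
    ((summable_floorSeries θ y').sub (summable_floorSeries θ y))) h.summable
  -- Since `y' ≤ y + 1`, each remaining floor changes by at most 1, and the weights beyond n sum to
  -- 2^{-n}.
  have h3 : ⌊y' - (((k + n : ℕ) : ℝ) + 1) * θ⌋ ≤ ⌊y - (((k + n : ℕ) : ℝ) + 1) * θ⌋ + 1 := by
    rw [← Int.floor_add_one]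
    exact Int.floor_le_floor (by linarith)
  have h4 : (⌊y' - (((k + n : ℕ) : ℝ) + 1) * θ⌋ : ℝ) ≤ ⌊y - (((k + n : ℕ) : ℝ) + 1) * θ⌋ + 1 := by
    exact_mod_cast h3
  rw [← mul_sub, show (1 / 2 : ℝ) ^ n * (1 / 2) ^ (k + 1) = (1 / 2) ^ (k + n + 1) by ring]
  calc _ ≤ (1 / 2 : ℝ) ^ (k + n + 1) * 1 := by gcongr; linarith
    _ = _ := mul_one _

/-- Density of the forward orbit of an irrational rotation. -/
theorem Irrational.exists_nat_mul_add_int_mem_Ioo {θ : ℝ} (hθ : Irrational θ) {a c : ℝ}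
    (hac : a < c) : ∃ (n : ℕ) (m : ℤ), n * θ + m ∈ Ioo a c := by
  have hd : DenseRange (fun n : ℕ => n • (θ : UnitAddCircle)) := by
    rw [← denseRange_zsmul_iff_nsmul]
    exact AddCircle.denseRange_zsmul_coe_iff.2 (by simpa using hθ)
  have ho : IsOpen ((fun x : ℝ => (x : UnitAddCircle)) '' Ioo a c) :=
    QuotientAddGroup.isOpenMap_coe _ isOpen_Ioo
  obtain ⟨n, z, hz, hzn⟩ := hd.exists_mem_open ho
    ⟨_, mem_image_of_mem _ (show (a + c) / 2 ∈ Ioo a c by constructor <;> linarith)⟩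
  have h0 : ((z - n * θ : ℝ) : UnitAddCircle) = 0 := by
    rw [AddCircle.coe_sub, sub_eq_zero, ← nsmul_eq_mul, AddCircle.coe_nsmul]
    exact hzn
  obtain ⟨m, hm⟩ := (AddCircle.coe_eq_zero_iff 1).1 h0
  rw [zsmul_one] at hm
  exact ⟨n, m, by rw [hm]; simpa using hz⟩

theorem Irrational.mul_succ_ne_int {θ : ℝ} (hθ : Irrational θ) (k : ℕ) (m : ℤ) :
    ((k : ℝ) + 1) * θ ≠ m := by
  have h := hθ.natCast_mul (Nat.succ_ne_zero k)
  push_cast at h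
  exact h.ne_int m

/-- The jumps sit at (k + 1)θ + m, and these are dense, so some term jumps between any two points.
-/
theorem floorSeries_strictMono {θ : ℝ} (hθ : Irrational θ) : StrictMono (floorSeries θ) := by
  intro y y' h
  obtain ⟨k, m, hk1, hk2⟩ :=
    hθ.exists_nat_mul_add_int_mem_Ioo (a := y - θ) (c := y' - θ) (by linarith)
  refine Summable.tsum_lt_tsum (i := k) (fun j => ?_) ?_ (summable_floorSeries θ y)
    (summable_floorSeries θ y')
  · have : ⌊y - (j + 1) * θ⌋ ≤ ⌊y' - (j + 1) * θ⌋ := Int.floor_le_floor (by linarith)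
    have : (⌊y - (j + 1) * θ⌋ : ℝ) ≤ ⌊y' - (j + 1) * θ⌋ := by exact_mod_cast this
    gcongr
  · have h1 : ⌊y - (k + 1) * θ⌋ < m := Int.floor_lt.2 (by linarith)
    have h2 : m ≤ ⌊y' - (k + 1) * θ⌋ := Int.le_floor.2 (by linarith)
    have : (⌊y - (k + 1) * θ⌋ : ℝ) < ⌊y' - (k + 1) * θ⌋ := by exact_mod_cast h1.trans_le h2
    gcongr

/-- Right continuity: finitely many floors are constant just to the right of y, and the tail is
small. -/
theorem exists_floorSeries_lt_add (θ y : ℝ) {ε : ℝ} (hε : 0 < ε) :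
    ∃ δ > 0, ∀ y' ∈ Ico y (y + δ), floorSeries θ y' < floorSeries θ y + ε := by
  obtain ⟨n, hn⟩ := exists_pow_lt_of_lt_one hε (show (1 / 2 : ℝ) < 1 by norm_num)
  have h1 : ∀ᶠ y' in 𝓝[≥] y, ∀ k ∈ Finset.range n,
      ⌊y' - ((k : ℝ) + 1) * θ⌋ = ⌊y - ((k : ℝ) + 1) * θ⌋ := by
    rw [Filter.eventually_all_finset]
    intro k _
    have ht : Tendsto (fun y' => y' - ((k : ℝ) + 1) * θ) (𝓝[≥] y)
        (𝓝[≥] (y - ((k : ℝ) + 1) * θ)) := by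
      refine tendsto_nhdsWithin_iff.2 ⟨?_, ?_⟩
      · exact ((continuous_sub_right _).tendsto y).mono_left nhdsWithin_le_nhds
      · filter_upwards [self_mem_nhdsWithin] with y' hy'
        exact sub_le_sub_right (mem_Ici.1 hy') _
    exact tendsto_pure.1 ((tendsto_floor_right_pure_floor _).comp ht)
  obtain ⟨u, hu, hsub⟩ := (mem_nhdsGE_iff_exists_Ico_subset).1 h1
  refine ⟨min (u - y) 1, lt_min (sub_pos.2 hu) one_pos, fun y' hy' => ?_⟩
  have h2 := hy'.2
  have h3 := min_le_left (u - y) 1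
  have h4 := min_le_right (u - y) 1
  have h5 := hsub ⟨hy'.1, by linarith⟩
  have := floorSeries_sub_le (θ := θ) (y := y) (y' := y') (n := n) (by linarith)
    fun k hk => (h5 k (Finset.mem_range.2 hk)).symm
  linarith

/-- Left continuity at 0, which is not a jump because no (k + 1)θ is an integer. -/
theorem exists_floorSeries_gt_sub {θ : ℝ} (hθ : Irrational θ) {ε : ℝ} (hε : 0 < ε) :
    ∃ z < 0, floorSeries θ 0 - ε < floorSeries θ z := by
  obtain ⟨n, hn⟩ := exists_pow_lt_of_lt_one hε (show (1 / 2 : ℝ) < 1 by norm_num)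
  have h1 : ∀ᶠ z in 𝓝 (0 : ℝ), ∀ k ∈ Finset.range n,
      ⌊z - ((k : ℝ) + 1) * θ⌋ = ⌊0 - ((k : ℝ) + 1) * θ⌋ := by
    rw [Filter.eventually_all_finset]
    intro k _
    have hne : (0 : ℝ) - (k + 1) * θ ≠ ⌊0 - ((k : ℝ) + 1) * θ⌋ := fun h =>
      hθ.mul_succ_ne_int k (-⌊0 - ((k : ℝ) + 1) * θ⌋) (by push_cast; linarith)
    have h2 : ∀ᶠ w in 𝓝 (0 - ((k : ℝ) + 1) * θ), ⌊w⌋ = ⌊0 - ((k : ℝ) + 1) * θ⌋ := by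
      filter_upwards [Ioo_mem_nhds (lt_of_le_of_ne (Int.floor_le _) hne.symm)
        (Int.lt_floor_add_one _)] with w hw
      exact Int.floor_eq_iff.2 ⟨hw.1.le, hw.2⟩
    exact ((continuous_sub_right (((k : ℝ) + 1) * θ)).tendsto 0).eventually h2
  have h2 : ∀ᶠ z in 𝓝[<] (0 : ℝ), -1 < z :=
    (lt_mem_nhds (by norm_num : (-1 : ℝ) < 0)).filter_mono nhdsWithin_le_nhds
  obtain ⟨z, ⟨hz, hz1⟩, hz0⟩ :=
    (((h1.filter_mono nhdsWithin_le_nhds).and h2).and self_mem_nhdsWithin).exists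
  refine ⟨z, hz0, ?_⟩
  have := floorSeries_sub_le (θ := θ) (y := z) (y' := 0) (n := n) (by linarith)
    fun k hk => hz k (Finset.mem_range.2 hk)
  linarith

/-! ### The contracted rotation and its coding by an irrational rotation -/

/-- The contracted rotation `u ↦ u / 2 + b` modulo `1`. -/
noncomputable def contractedRot (b u : ℝ) : ℝ := Int.fract (u / 2 + b)

/-- The translation parameter of the contracted rotation with rotation number `θ`. -/
noncomputable def rotParam (θ : ℝ) : ℝ := -floorSeries θ 0 / 2

/-- The monotone map conjugating the rotation by `θ` to the contracted rotation. -/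
noncomputable def rotCoding (θ y : ℝ) : ℝ := floorSeries θ y - floorSeries θ 0

/-- The attractor of the contracted rotation with rotation number `θ`. -/
def rotAttractor (θ : ℝ) : Set ℝ := closure (rotCoding θ '' Ico 0 1)

/-- The lift to `ℝ` of the contracted rotation. -/
noncomputable def contractedRotLift (b x : ℝ) : ℝ := x / 2 + ⌊x⌋ / 2 + b

theorem contractedRot_mem (b u : ℝ) : contractedRot b u ∈ Ico (0 : ℝ) 1 :=
  ⟨Int.fract_nonneg _, Int.fract_lt_one _⟩

theorem contractedRot_iterate_mem (b : ℝ) {u : ℝ} (hu : u ∈ Ico (0 : ℝ) 1) (n : ℕ) :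
    (contractedRot b)^[n] u ∈ Ico (0 : ℝ) 1 :=
  MapsTo.iterate (fun _ _ => contractedRot_mem b _) n hu

theorem fract_contractedRotLift (b x : ℝ) :
    Int.fract (contractedRotLift b x) = contractedRot b (Int.fract x) := by
  rw [contractedRot, Int.fract_eq_fract]
  refine ⟨⌊x⌋, ?_⟩
  rw [contractedRotLift, Int.fract]
  ring

theorem fract_contractedRotLift_iterate (b x : ℝ) (n : ℕ) :
    Int.fract ((contractedRotLift b)^[n] x) = (contractedRot b)^[n] (Int.fract x) := by
  induction n with
  | zero => rfl
  | succ n ih =>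
    rw [Function.iterate_succ_apply', Function.iterate_succ_apply', fract_contractedRotLift, ih]

theorem contractedRotLift_mono (b : ℝ) : Monotone (contractedRotLift b) := fun x y h => by
  have : (⌊x⌋ : ℝ) ≤ ⌊y⌋ := by exact_mod_cast Int.floor_le_floor h
  unfold contractedRotLift
  linarith

section Coding

variable {θ : ℝ}

theorem rotCoding_zero : rotCoding θ 0 = 0 := sub_self _

theorem rotCoding_add_one (y : ℝ) : rotCoding θ (y + 1) = rotCoding θ y + 1 := by
  rw [rotCoding, rotCoding, floorSeries_add_one]
  ring

theorem rotCoding_add_int (y : ℝ) (m : ℤ) : rotCoding θ (y + m) = rotCoding θ y + m := by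
  induction m using Int.induction_on with
  | zero => simp
  | succ i ih =>
    push_cast at ih ⊢
    rw [← add_assoc, rotCoding_add_one, ih]
    ring
  | pred i ih =>
    have := rotCoding_add_one (θ := θ) (y + ((-i - 1 : ℤ) : ℝ))
    push_cast at ih this ⊢
    rw [show y + (-(i : ℝ) - 1) + 1 = y + -i by ring, ih] at this
    linarith

theorem rotCoding_int (m : ℤ) : rotCoding θ m = m := by
  simpa [rotCoding_zero] using rotCoding_add_int (θ := θ) 0 m

theorem rotCoding_strictMono (hθ : Irrational θ) : StrictMono (rotCoding θ) := fun _ _ h =>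
  sub_lt_sub_right (floorSeries_strictMono hθ h) _

theorem rotCoding_floor_le (hθ : Irrational θ) (y : ℝ) : ⌊y⌋ ≤ rotCoding θ y := by
  rw [← rotCoding_int (θ := θ)]
  exact (rotCoding_strictMono hθ).monotone (Int.floor_le y)

theorem floor_rotCoding (hθ : Irrational θ) (y : ℝ) : ⌊rotCoding θ y⌋ = ⌊y⌋ := by
  refine Int.floor_eq_iff.2 ⟨rotCoding_floor_le hθ y, ?_⟩
  have := rotCoding_strictMono hθ (Int.lt_floor_add_one y)
  rwa [rotCoding_add_one, rotCoding_int] at this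

theorem rotCoding_fract (y : ℝ) : rotCoding θ (Int.fract y) = rotCoding θ y - ⌊y⌋ := by
  have := rotCoding_add_int (θ := θ) y (-⌊y⌋)
  push_cast at this
  rw [Int.fract, sub_eq_add_neg, this, sub_eq_add_neg]

theorem rotCoding_mem_Ico (hθ : Irrational θ) {y : ℝ} (hy : y ∈ Ico (0 : ℝ) 1) :
    rotCoding θ y ∈ Ico (0 : ℝ) 1 := by
  have h := floor_rotCoding hθ y
  rw [Int.floor_eq_zero_iff.2 hy] at h
  exact Int.floor_eq_zero_iff.1 h

theorem rotCoding_add (hθ : Irrational θ) (y : ℝ) :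
    rotCoding θ (y + θ) = contractedRotLift (rotParam θ) (rotCoding θ y) := by
  rw [contractedRotLift, floor_rotCoding hθ, rotCoding, rotCoding, floorSeries_add, rotParam]
  ring

theorem exists_rotCoding_lt_add (y : ℝ) {ε : ℝ} (hε : 0 < ε) :
    ∃ δ > 0, ∀ y' ∈ Ico y (y + δ), rotCoding θ y' < rotCoding θ y + ε := by
  obtain ⟨δ, hδ, h⟩ := exists_floorSeries_lt_add θ y hε
  refine ⟨δ, hδ, fun y' hy' => ?_⟩
  have := h y' hy'
  unfold rotCoding
  linarith

/-- A point enclosed between the left limit and the value of the coding at `w` has the same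
integer part as `w`. -/
theorem floor_eq_of_enclosed (hθ : Irrational θ) {w x : ℝ} (h1 : ∀ z < w, rotCoding θ z ≤ x)
    (h2 : x ≤ rotCoding θ w) : ⌊x⌋ = ⌊w⌋ := by
  refine le_antisymm ?_ (Int.le_floor.2 ?_)
  · rw [← floor_rotCoding hθ w]
    exact Int.floor_le_floor h2
  · rcases (Int.floor_le w).lt_or_eq with h | h
    · simpa [rotCoding_int] using h1 _ h
    -- For integer w the enclosure only controls the left limit at w; left continuity of the coding
    -- at integers makes that limit w itself.
    · refine le_of_forall_pos_lt_add fun ε hε => ?_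
      obtain ⟨z, hz, hlt⟩ := exists_floorSeries_gt_sub hθ hε
      have h3 := h1 (z + ⌊w⌋) (by linarith)
      rw [rotCoding_add_int, rotCoding] at h3
      linarith

/-! ### Asymptotics of the contracted rotation -/

/-- Every orbit of the contracted rotation is exponentially asymptotic to a coded orbit. -/
theorem exists_shadowing (hθ : Irrational θ) {v : ℝ} (hv : v ∈ Ico (0 : ℝ) 1) :
    ∃ y : ℝ, ∀ n : ℕ, |(contractedRot (rotParam θ))^[n] v
      - rotCoding θ (Int.fract (y + n * θ))| ≤ (1 / 2) ^ n := by
  have hmono := rotCoding_strictMono hθ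
  have hone : rotCoding θ 1 = 1 := by simpa using rotCoding_int (θ := θ) 1
  -- The supremum of S is the point where the coding passes v, by a jump or by equality.
  set S : Set ℝ := {z | rotCoding θ z ≤ v} with hS
  have hSlt : ∀ z ∈ S, z < 1 := fun z hz => hmono.lt_iff_lt.1 (by
    rw [hone]; exact lt_of_le_of_lt hz hv.2)
  have hSbdd : BddAbove S := ⟨1, fun z hz => (hSlt z hz).le⟩
  have h0S : (0 : ℝ) ∈ S := by rw [hS, mem_ofPred_eq, rotCoding_zero]; exact hv.1
  set y := sSup S with hy
  have hy1 : y ≤ 1 := csSup_le ⟨0, h0S⟩ fun z hz => (hSlt z hz).le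
  have h1 : ∀ z < y, rotCoding θ z ≤ v := fun z hz => by
    obtain ⟨z', hz', hlt⟩ := exists_lt_of_lt_csSup ⟨0, h0S⟩ hz
    exact (hmono hlt).le.trans hz'
  have h2 : v ≤ rotCoding θ y := by
    by_contra! hlt
    obtain ⟨δ, hδ, h⟩ := exists_rotCoding_lt_add (θ := θ) y (sub_pos.2 hlt)
    have h3 := h (y + δ / 2) ⟨by linarith, by linarith⟩
    have h4 : y + δ / 2 ∈ S := by
      rw [hS, mem_ofPred_eq]
      linarith
    have := le_csSup hSbdd h4
    linarith
  set b := rotParam θ with hb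
  -- Monotonicity of the lift propagates the enclosure; the enclosure forces equal integer parts, so
  -- each step exactly halves the distance to the coded orbit.
  have key : ∀ n : ℕ, (∀ z < y + n * θ, rotCoding θ z ≤ (contractedRotLift b)^[n] v) ∧
      (contractedRotLift b)^[n] v ≤ rotCoding θ (y + n * θ) ∧
      rotCoding θ (y + n * θ) - (contractedRotLift b)^[n] v ≤ (1 / 2) ^ n := by
    intro n
    induction n with
    | zero =>
      simp only [Nat.cast_zero, zero_mul, add_zero, Function.iterate_zero, id, pow_zero]
      refine ⟨h1, h2, ?_⟩
      have := hmono.monotone hy1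
      have := hv.1
      linarith
    | succ n ih =>
      obtain ⟨i1, i2, i3⟩ := ih
      have he : y + ((n + 1 : ℕ) : ℝ) * θ = y + n * θ + θ := by push_cast; ring
      rw [Function.iterate_succ_apply', he, rotCoding_add hθ]
      refine ⟨fun z hz => ?_, contractedRotLift_mono b i2, ?_⟩
      · rw [← sub_add_cancel z θ, rotCoding_add hθ]
        exact contractedRotLift_mono b (i1 _ (by linarith))
      · have hf := floor_eq_of_enclosed hθ i1 i2
        rw [contractedRotLift, contractedRotLift, hf, floor_rotCoding hθ, pow_succ]
        linarith
  refine ⟨y, fun n => ?_⟩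
  obtain ⟨i1, i2, i3⟩ := key n
  have hf := floor_eq_of_enclosed hθ i1 i2
  have hfr : (contractedRot b)^[n] v = (contractedRotLift b)^[n] v - ⌊y + n * θ⌋ := by
    rw [← hf]
    have := fract_contractedRotLift_iterate b v n
    rw [Int.fract_eq_self.2 hv] at this
    exact this.symm
  rw [rotCoding_fract, hfr, abs_le]
  have : (0 : ℝ) ≤ (1 / 2) ^ n := by positivity
  constructor <;> linarith

theorem exists_rotCoding_fract_near (hθ : Irrational θ) (y : ℝ) {z : ℝ} (hz : z ∈ Ico (0 : ℝ) 1)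
    {ε : ℝ} (hε : 0 < ε) (N : ℕ) :
    ∃ n ≥ N, |rotCoding θ (Int.fract (y + n * θ)) - rotCoding θ z| < ε := by
  obtain ⟨δ, hδ, h⟩ := exists_rotCoding_lt_add (θ := θ) z hε
  -- The coding is only right continuous, so z is approached from the right; the cap 1 - z keeps the
  -- representative in [0, 1).
  have hm : 0 < min δ (1 - z) := lt_min hδ (sub_pos.2 hz.2)
  obtain ⟨n, m, h1, h2⟩ := hθ.exists_nat_mul_add_int_mem_Ioo
    (show z - y - N * θ < z - y - N * θ + min δ (1 - z) by linarith)
  have h3 := min_le_left δ (1 - z)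
  have h4 := min_le_right δ (1 - z)
  have hz0 := hz.1
  have hfr : Int.fract (y + ((n + N : ℕ) : ℝ) * θ) = y + ((n + N : ℕ) : ℝ) * θ + m := by
    refine Int.fract_eq_iff.2 ⟨?_, ?_, -m, ?_⟩ <;> push_cast <;> linarith
  refine ⟨n + N, Nat.le_add_left _ _, ?_⟩
  rw [hfr]
  have h5 := h (y + ((n + N : ℕ) : ℝ) * θ + m) ⟨by push_cast; linarith, by push_cast; linarith⟩
  have h6 : rotCoding θ z ≤ rotCoding θ (y + ((n + N : ℕ) : ℝ) * θ + m) :=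
    (rotCoding_strictMono hθ).monotone (by push_cast; linarith)
  rw [abs_lt]
  constructor <;> linarith

theorem mapClusterPt_contractedRot_iff (hθ : Irrational θ) {v : ℝ} (hv : v ∈ Ico (0 : ℝ) 1)
    {z : ℝ} : MapClusterPt z atTop (fun n => (contractedRot (rotParam θ))^[n] v) ↔
      z ∈ rotAttractor θ := by
  obtain ⟨y, hy⟩ := exists_shadowing hθ hv
  have hsmall : ∀ ε > 0, ∀ᶠ n : ℕ in atTop, ((1 : ℝ) / 2) ^ n < ε := fun ε hε =>
    (tendsto_pow_atTop_nhds_zero_of_lt_one (by norm_num) (by norm_num)).eventually_lt_const hε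
  rw [mapClusterPt_iff_frequently, rotAttractor, Metric.mem_closure_iff]
  constructor
  · intro h ε hε
    obtain ⟨n, hn1, hn2⟩ := ((h _ (Metric.ball_mem_nhds z (half_pos hε))).and_eventually
      (hsmall _ (half_pos hε))).exists
    refine ⟨_, mem_image_of_mem _ ⟨Int.fract_nonneg (y + n * θ), Int.fract_lt_one _⟩, ?_⟩
    have h1 := hy n
    rw [Metric.mem_ball'] at hn1
    refine (dist_triangle _ _ _).trans_lt (lt_of_lt_of_le (add_lt_add_of_lt_of_le hn1 h1) ?_)
    linarith
  · intro h s hs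
    obtain ⟨ε, hε, hsub⟩ := Metric.mem_nhds_iff.1 hs
    obtain ⟨_, ⟨z', hz', rfl⟩, hd⟩ := h (ε / 3) (by linarith)
    rw [frequently_atTop]
    intro N
    obtain ⟨N', hN'⟩ := eventually_atTop.1 (hsmall (ε / 3) (by linarith))
    obtain ⟨n, hn, hlt⟩ := exists_rotCoding_fract_near hθ y hz' (show 0 < ε / 3 by linarith)
      (max N N')
    refine ⟨n, (le_max_left _ _).trans hn, hsub ?_⟩
    have h1 := hy n
    have h2 := hN' n ((le_max_right _ _).trans hn)
    rw [Metric.mem_ball]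
    have t1 := dist_triangle ((contractedRot (rotParam θ))^[n] v)
      (rotCoding θ (Int.fract (y + n * θ))) z
    have t2 := dist_triangle (rotCoding θ (Int.fract (y + n * θ))) (rotCoding θ z') z
    rw [dist_comm (rotCoding θ z') z] at t2
    rw [← Real.dist_eq] at h1 hlt
    linarith

/-- The shadowing bound 2^{-n} does not depend on the starting point, so a point with preimages of
every order is arbitrarily close to the coded set. -/
theorem mem_rotAttractor_of_forall_exists_iterate (hθ : Irrational θ) {u : ℝ}
    (hu : ∀ n, ∃ v ∈ Ico (0 : ℝ) 1, (contractedRot (rotParam θ))^[n] v = u) :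
    u ∈ rotAttractor θ := by
  rw [rotAttractor, Metric.mem_closure_iff]
  intro ε hε
  obtain ⟨n, hn⟩ := exists_pow_lt_of_lt_one hε (show (1 / 2 : ℝ) < 1 by norm_num)
  obtain ⟨v, hv, rfl⟩ := hu n
  obtain ⟨y, hy⟩ := exists_shadowing hθ hv
  exact ⟨_, mem_image_of_mem _ ⟨Int.fract_nonneg (y + n * θ), Int.fract_lt_one _⟩,
    (hy n).trans_lt hn⟩

/-! ### Perfectness and location of the attractor -/

theorem rotAttractor_nonempty : (rotAttractor θ).Nonempty :=
  ⟨rotCoding θ 0, subset_closure (mem_image_of_mem _ ⟨le_rfl, one_pos⟩)⟩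

theorem preperfect_rotCoding_image (hθ : Irrational θ) :
    Preperfect (rotCoding θ '' Ico 0 1) := by
  rw [preperfect_iff_nhds]
  rintro _ ⟨y, hy, rfl⟩ U hU
  obtain ⟨ε, hε, hsub⟩ := Metric.mem_nhds_iff.1 hU
  obtain ⟨δ, hδ, h⟩ := exists_rotCoding_lt_add (θ := θ) y hε
  have hm : 0 < min δ (1 - y) := lt_min hδ (sub_pos.2 hy.2)
  have h3 := min_le_left δ (1 - y)
  have h4 := min_le_right δ (1 - y)
  have hlt : rotCoding θ y < rotCoding θ (y + min δ (1 - y) / 2) :=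
    rotCoding_strictMono hθ (by linarith)
  have h5 := h (y + min δ (1 - y) / 2) ⟨by linarith, by linarith⟩
  refine ⟨_, ⟨hsub ?_, mem_image_of_mem _ ⟨?_, ?_⟩⟩, hlt.ne'⟩
  · rw [Metric.mem_ball, Real.dist_eq, abs_lt]
    constructor <;> linarith
  · linarith [hy.1]
  · linarith

theorem perfect_rotAttractor (hθ : Irrational θ) : Perfect (rotAttractor θ) :=
  (preperfect_rotCoding_image hθ).perfect_closure

theorem rotParam_lt_one (hθ : Irrational θ) (h1 : θ < 1) : rotParam θ < 1 := by
  have h := rotCoding_add hθ 0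
  rw [zero_add, rotCoding_zero, contractedRotLift, Int.floor_zero] at h
  have h2 := rotCoding_strictMono hθ h1
  have h3 := rotCoding_int (θ := θ) 1
  push_cast at h h3
  linarith

/-- One rotation step takes 1 - θ to 1, so 1 = c/2 + b, where c < 1 is the coding of 1 - θ. -/
theorem half_lt_rotParam (hθ : Irrational θ) (h0 : 0 < θ) (h1 : θ < 1) : 1 / 2 < rotParam θ := by
  have h := rotCoding_add hθ (1 - θ)
  have h3 := rotCoding_int (θ := θ) 1
  have h2 := rotCoding_strictMono hθ (show 1 - θ < 1 by linarith)
  rw [contractedRotLift, floor_rotCoding hθ,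
    Int.floor_eq_zero_iff.2 (show 1 - θ ∈ Ico (0 : ℝ) 1 from ⟨by linarith, by linarith⟩),
    sub_add_cancel] at h
  push_cast at h h3
  linarith

theorem contractedRot_mem_union {b u : ℝ} (hb0 : 1 / 2 < b) (hb1 : b < 1)
    (hu : u ∈ Ico (0 : ℝ) 1) : contractedRot b u ∈ Icc 0 (b - 1 / 2) ∪ Icc b 1 := by
  obtain ⟨h0, h1⟩ := hu
  rw [contractedRot]
  by_cases h : u / 2 + b < 1
  · rw [Int.fract_eq_self.2 ⟨by linarith, h⟩]
    right
    constructor <;> linarith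
  · have : Int.fract (u / 2 + b) = u / 2 + b - 1 :=
      Int.fract_eq_iff.2 ⟨by linarith, by linarith, 1, by push_cast; ring⟩
    rw [this]
    left
    constructor <;> linarith

/-- Each coded point is the image of another one, hence avoids the gap (b - 1/2, b) omitted by the
contracted rotation. The gap contains 1/2, where `trapChart` is discontinuous. -/
theorem rotAttractor_subset (hθ : Irrational θ) (h0 : 0 < θ) (h1 : θ < 1) :
    rotAttractor θ ⊆ Icc 0 (rotParam θ - 1 / 2) ∪ Icc (rotParam θ) 1 := by
  refine closure_minimal ?_ (isClosed_Icc.union isClosed_Icc)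
  rintro _ ⟨y, hy, rfl⟩
  have hfr : Int.fract (Int.fract (y - θ) + θ) = y := by
    refine Int.fract_eq_iff.2 ⟨hy.1, hy.2, -⌊y - θ⌋, ?_⟩
    rw [Int.fract]
    push_cast
    ring
  have hz : Int.fract (y - θ) ∈ Ico (0 : ℝ) 1 := ⟨Int.fract_nonneg _, Int.fract_lt_one _⟩
  have hz' := rotCoding_mem_Ico hθ hz
  have h : rotCoding θ y = contractedRot (rotParam θ) (rotCoding θ (Int.fract (y - θ))) := by
    conv_lhs => rw [← hfr, rotCoding_fract, ← floor_rotCoding hθ]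
    have := fract_contractedRotLift (rotParam θ) (rotCoding θ (Int.fract (y - θ)))
    rw [← rotCoding_add hθ, Int.fract_eq_self.2 hz'] at this
    exact this
  rw [h]
  exact contractedRot_mem_union (half_lt_rotParam hθ h0 h1) (rotParam_lt_one hθ h1) hz'

theorem isCompact_rotAttractor (hθ : Irrational θ) (h0 : 0 < θ) (h1 : θ < 1) :
    IsCompact (rotAttractor θ) :=
  (isCompact_Icc.union isCompact_Icc).of_isClosed_subset isClosed_closure
    (rotAttractor_subset hθ h0 h1)

end Coding

/-! ### Hausdorff dimension zero -/

section Hausdorff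

variable {θ : ℝ}

/-- Number of the first `n` jumps of the coding in `(0, y]`. -/
noncomputable def jumpCount (θ : ℝ) (n : ℕ) (y : ℝ) : ℤ :=
  ∑ k ∈ Finset.range n, (⌊y - ((k : ℝ) + 1) * θ⌋ - ⌊0 - ((k : ℝ) + 1) * θ⌋)

theorem jumpCount_mem {n : ℕ} {y : ℝ} (hy : y ∈ Ico (0 : ℝ) 1) :
    0 ≤ jumpCount θ n y ∧ jumpCount θ n y ≤ n := by
  constructor
  · refine Finset.sum_nonneg fun k _ => sub_nonneg.2 (Int.floor_le_floor ?_)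
    linarith [hy.1]
  · have h : ∀ k ∈ Finset.range n,
        ⌊y - ((k : ℝ) + 1) * θ⌋ - ⌊0 - ((k : ℝ) + 1) * θ⌋ ≤ 1 := fun k _ => by
      rw [sub_le_iff_le_add', ← Int.floor_add_one, add_comm]
      exact Int.floor_le_floor (by linarith [hy.2])
    have := Finset.sum_le_card_nsmul _ _ _ h
    rwa [Finset.card_range, nsmul_eq_mul, mul_one] at this

/-- Each summand is monotone in y, so equal sums force equality term by term. -/
theorem floor_eq_of_jumpCount_eq {n : ℕ} {y y' : ℝ} (hle : y ≤ y')
    (h : jumpCount θ n y = jumpCount θ n y') (k : ℕ) (hk : k < n) :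
    ⌊y - ((k : ℝ) + 1) * θ⌋ = ⌊y' - ((k : ℝ) + 1) * θ⌋ := by
  have hmono : ∀ k ∈ Finset.range n, ⌊y - ((k : ℝ) + 1) * θ⌋ - ⌊0 - ((k : ℝ) + 1) * θ⌋
      ≤ ⌊y' - ((k : ℝ) + 1) * θ⌋ - ⌊0 - ((k : ℝ) + 1) * θ⌋ := fun k _ =>
    sub_le_sub_right (Int.floor_le_floor (by linarith)) _
  have := (Finset.sum_eq_sum_iff_of_le hmono).1 h k (Finset.mem_range.2 hk)
  linarith

theorem ediam_image_jumpCount_le (hθ : Irrational θ) (n : ℕ) (j : ℤ) :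
    Metric.ediam (rotCoding θ '' {y | y ∈ Ico (0 : ℝ) 1 ∧ jumpCount θ n y = j}) ≤
      ENNReal.ofReal ((1 / 2) ^ n) := by
  refine Metric.ediam_le ?_
  have key : ∀ y y' : ℝ, y ∈ Ico (0 : ℝ) 1 → y' ∈ Ico (0 : ℝ) 1 → jumpCount θ n y = jumpCount θ n y' →
      y ≤ y' → |rotCoding θ y - rotCoding θ y'| ≤ (1 / 2) ^ n := fun y y' hy hy' h hle => by
    have h1 := floorSeries_sub_le (θ := θ) (show y' ≤ y + 1 by linarith [hy.1, hy'.2])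
      (floor_eq_of_jumpCount_eq hle h)
    have h2 := (rotCoding_strictMono hθ).monotone hle
    rw [abs_sub_comm, abs_of_nonneg (sub_nonneg.2 h2), rotCoding, rotCoding]
    linarith
  rintro _ ⟨y, ⟨hy, hj⟩, rfl⟩ _ ⟨y', ⟨hy', hj'⟩, rfl⟩
  rw [edist_dist, Real.dist_eq]
  refine ENNReal.ofReal_le_ofReal ?_
  rcases le_total y y' with h | h
  · exact key y y' hy hy' (hj.trans hj'.symm) h
  · rw [abs_sub_comm]
    exact key y' y hy' hy (hj'.trans hj.symm) h

theorem rotAttractor_subset_iUnion (n : ℕ) :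
    rotAttractor θ ⊆ ⋃ i : Fin (n + 1),
      closure (rotCoding θ '' {y | y ∈ Ico (0 : ℝ) 1 ∧ jumpCount θ n y = (i : ℕ)}) := by
  refine closure_minimal ?_ (isClosed_iUnion_of_finite fun _ => isClosed_closure)
  rintro _ ⟨y, hy, rfl⟩
  obtain ⟨h0, hn⟩ := jumpCount_mem (θ := θ) (n := n) hy
  refine mem_iUnion.2 ⟨⟨(jumpCount θ n y).toNat, by omega⟩, subset_closure ⟨y, ⟨hy, ?_⟩, rfl⟩⟩
  simp [h0]

/-- The covers by level sets of `jumpCount` give s-sums at most (n + 1)2^{-ns}, which tend to 0. -/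
theorem hausdorffMeasure_rotAttractor (hθ : Irrational θ) {s : ℝ} (hs : 0 < s) :
    μH[s] (rotAttractor θ) = 0 := by
  have hr0 : Tendsto (fun n : ℕ => ENNReal.ofReal ((1 / 2 : ℝ) ^ n)) atTop (𝓝 0) := by
    rw [← ENNReal.ofReal_zero]
    exact ENNReal.tendsto_ofReal
      (tendsto_pow_atTop_nhds_zero_of_lt_one (by norm_num) (by norm_num))
  have hd : ∀ (n : ℕ) (i : Fin (n + 1)), Metric.ediam
      (closure (rotCoding θ '' {y | y ∈ Ico (0 : ℝ) 1 ∧ jumpCount θ n y = (i : ℕ)})) ≤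
      ENNReal.ofReal ((1 / 2) ^ n) := fun n i => by
    rw [Metric.ediam_closure]
    exact ediam_image_jumpCount_le hθ n _
  have h := Measure.hausdorffMeasure_le_liminf_sum s (rotAttractor θ) (l := atTop) _ hr0
    (fun n (i : Fin (n + 1)) =>
      closure (rotCoding θ '' {y | y ∈ Ico (0 : ℝ) 1 ∧ jumpCount θ n y = (i : ℕ)}))
    (Eventually.of_forall hd) (Eventually.of_forall fun n => rotAttractor_subset_iUnion n)
  have hq0 : (0 : ℝ) ≤ (1 / 2) ^ s := by positivity
  have hq1 : ((1 : ℝ) / 2) ^ s < 1 := Real.rpow_lt_one (by norm_num) (by norm_num) hs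
  have hlim : Tendsto (fun n : ℕ => ENNReal.ofReal (((n : ℝ) + 1) * ((1 / 2 : ℝ) ^ s) ^ n)) atTop
      (𝓝 0) := by
    rw [← ENNReal.ofReal_zero]
    refine ENNReal.tendsto_ofReal ?_
    have := (tendsto_self_mul_const_pow_of_lt_one hq0 hq1).add
      (tendsto_pow_atTop_nhds_zero_of_lt_one hq0 hq1)
    rw [add_zero] at this
    refine this.congr fun n => ?_
    ring
  have hle : ∀ n : ℕ, ∑ i : Fin (n + 1), Metric.ediam (closure
      (rotCoding θ '' {y | y ∈ Ico (0 : ℝ) 1 ∧ jumpCount θ n y = (i : ℕ)})) ^ s ≤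
      ENNReal.ofReal (((n : ℝ) + 1) * ((1 / 2 : ℝ) ^ s) ^ n) := fun n => by
    have h1 : ∀ i ∈ (Finset.univ : Finset (Fin (n + 1))), Metric.ediam (closure
        (rotCoding θ '' {y | y ∈ Ico (0 : ℝ) 1 ∧ jumpCount θ n y = (i : ℕ)})) ^ s ≤
        ENNReal.ofReal (((1 / 2 : ℝ) ^ s) ^ n) := fun i _ => by
      refine (ENNReal.rpow_le_rpow (hd n i) hs.le).trans_eq ?_
      rw [ENNReal.ofReal_rpow_of_nonneg (by positivity) hs.le, ← Real.rpow_natCast,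
        ← Real.rpow_natCast, ← Real.rpow_mul (by norm_num), ← Real.rpow_mul (by norm_num), mul_comm]
    refine (Finset.sum_le_card_nsmul _ _ _ h1).trans_eq ?_
    rw [Finset.card_univ, Fintype.card_fin, nsmul_eq_mul, ENNReal.ofReal_mul (by positivity)]
    congr 1
    rw [← Nat.cast_succ, ENNReal.ofReal_natCast]
  refine le_antisymm (h.trans ?_) zero_le
  rw [← (tendsto_of_tendsto_of_tendsto_of_le_of_le tendsto_const_nhds hlim
    (fun _ => zero_le) hle).liminf_eq]

end Hausdorff

/-! ### Images under maps affine on both sides of `1 / 2` -/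

/-- The map affine with slope `c` on both sides of `1 / 2`. -/
noncomputable def brokenMap (c d e u : ℝ) : ℝ := if u < 1 / 2 then c * u + d else c * u + e

section Broken

variable {c d e : ℝ}

theorem brokenMap_of_lt {u : ℝ} (h : u < 1 / 2) : brokenMap c d e u = c * u + d := if_pos h

theorem brokenMap_of_le {u : ℝ} (h : 1 / 2 ≤ u) : brokenMap c d e u = c * u + e :=
  if_neg (not_lt.2 h)

theorem brokenMap_eventuallyEq {u : ℝ} (hu : u ≠ 1 / 2) :
    ∃ a, brokenMap c d e =ᶠ[𝓝 u] fun v => c * v + a := by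
  rcases hu.lt_or_gt with h | h
  · exact ⟨d, by filter_upwards [Iio_mem_nhds h] with v hv using brokenMap_of_lt hv⟩
  · exact ⟨e, by filter_upwards [Ioi_mem_nhds h] with v hv using brokenMap_of_le (le_of_lt hv)⟩

theorem continuousAt_brokenMap {u : ℝ} (hu : u ≠ 1 / 2) : ContinuousAt (brokenMap c d e) u := by
  obtain ⟨a, ha⟩ := brokenMap_eventuallyEq (c := c) (d := d) (e := e) hu
  exact ContinuousAt.congr (by fun_prop) ha.symm

theorem hausdorffMeasure_brokenMap_image {A : Set ℝ} {s : ℝ} (hs : 0 ≤ s) (hA : μH[s] A = 0) :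
    μH[s] (brokenMap c d e '' A) = 0 := by
  have hl : ∀ a : ℝ, μH[s] ((fun u => c * u + a) '' A) = 0 := fun a => by
    have hL : LipschitzWith ‖c‖₊ fun u : ℝ => c * u + a := LipschitzWith.of_dist_le_mul fun u v => by
      rw [Real.dist_eq, Real.dist_eq, coe_nnnorm, Real.norm_eq_abs, ← abs_mul]
      apply le_of_eq
      congr 1
      ring
    have := hL.hausdorffMeasure_image_le hs A
    rw [hA, mul_zero] at this
    exact le_antisymm this zero_le
  refine measure_mono_null ?_ (measure_union_null (hl d) (hl e))
  rintro _ ⟨u, hu, rfl⟩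
  rcases lt_or_ge u (1 / 2) with h | h
  · exact Or.inl ⟨u, hu, (brokenMap_of_lt h).symm⟩
  · exact Or.inr ⟨u, hu, (brokenMap_of_le h).symm⟩

theorem isTotallyDisconnected_of_volume_eq_zero {A : Set ℝ} (hA : volume A = 0) :
    IsTotallyDisconnected A := by
  intro T hT hpre x hx y hy
  by_contra hne
  wlog h : x < y generalizing x y
  · exact this hy hx (Ne.symm hne) (lt_of_le_of_ne (not_lt.1 h) (Ne.symm hne))
  have := measure_mono_null ((hpre.Icc_subset hx hy).trans hT) hA
  rw [Real.volume_Icc, ENNReal.ofReal_eq_zero] at this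
  linarith

/-- Away from 1/2 the map is locally affine and injective, so it preserves accumulation. Total
disconnectedness comes from the image being Lebesgue null. -/
theorem isCantorSet_brokenMap_image (hc : c ≠ 0) {A : Set ℝ} (hne : A.Nonempty)
    (hA : IsCompact A) (hP : Preperfect A) (h2 : (1 / 2 : ℝ) ∉ A) (hm : μH[1] A = 0) :
    IsCantorSet (brokenMap c d e '' A) := by
  have hcpt : IsCompact (brokenMap c d e '' A) := hA.image_of_continuousOn fun u hu =>
    (continuousAt_brokenMap (fun h => h2 (h ▸ hu))).continuousWithinAt
  refine ⟨hne.image _, hcpt, ⟨hcpt.isClosed, ?_⟩, isTotallyDisconnected_of_volume_eq_zero ?_⟩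
  · rw [preperfect_iff_nhds] at hP ⊢
    rintro _ ⟨u, hu, rfl⟩ U hU
    have hu2 : u ≠ 1 / 2 := fun h => h2 (h ▸ hu)
    obtain ⟨a, ha⟩ := brokenMap_eventuallyEq (c := c) (d := d) (e := e) hu2
    obtain ⟨v, ⟨⟨hvU, hva⟩, hvA⟩, hvu⟩ := hP u hu _
      (inter_mem ((continuousAt_brokenMap hu2).preimage_mem_nhds hU) ha)
    refine ⟨_, ⟨hvU, mem_image_of_mem _ hvA⟩, ?_⟩
    rw [ha.self_of_nhds, (show brokenMap c d e v = c * v + a from hva)]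
    intro h
    exact hvu (mul_left_cancel₀ hc (add_right_cancel h))
  · rw [← hausdorffMeasure_real]
    exact hausdorffMeasure_brokenMap_image zero_le_one hm

/-- Continuity is needed only on E: by compactness, an ultrafilter realising a cluster point of the
image sequence also converges upstairs, in E. -/
theorem setOf_mapClusterPt_comp_eq_image {X Y : Type*} [TopologicalSpace X] [TopologicalSpace Y]
    [T2Space Y] {g : X → Y} {E : Set X} (hE : IsCompact E)
    (hg : ∀ z ∈ E, ContinuousAt g z) {u : ℕ → X} (hu : ∀ᶠ n in atTop, u n ∈ E)
    {A : Set X} (hA : ∀ z, MapClusterPt z atTop u ↔ z ∈ A) (hAE : A ⊆ E) :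
    {w | MapClusterPt w atTop (g ∘ u)} = g '' A := by
  ext w
  constructor
  · intro h
    obtain ⟨U, hU, hw⟩ := mapClusterPt_iff_ultrafilter.1 h
    have hUE : ((U.map u : Ultrafilter X) : Filter X) ≤ 𝓟 E := by
      rw [le_principal_iff, Ultrafilter.coe_map, mem_map]
      exact hU hu
    obtain ⟨z, hz, hzU⟩ := hE.ultrafilter_le_nhds _ hUE
    refine ⟨z, (hA z).1 (mapClusterPt_iff_ultrafilter.2 ⟨U, hU, hzU⟩), ?_⟩
    exact tendsto_nhds_unique ((hg z hz).tendsto.comp hzU) hw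
  · rintro ⟨z, hz, rfl⟩
    exact ((hA z).2 hz).tendsto_comp (hg z (hAE hz))

end Broken

theorem omegaLim_eq_setOf_mapClusterPt_add (f : ℝ → ℝ) (x : ℝ) (N : ℕ) :
    omegaLim f x = {z | MapClusterPt z atTop fun n => f^[n + N] x} := by
  ext z
  rw [omegaLim, mem_omegaLimit_singleton_iff_mapClusterPt, mem_ofPred_eq, MapClusterPt,
    MapClusterPt, ← map_add_atTop_eq_nat N, map_map]
  rw [map_add_atTop_eq_nat N]
  rfl

theorem omegaLim_eq_brokenMap_image {θ : ℝ} (hθ : Irrational θ) (h0 : 0 < θ) (h1 : θ < 1)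
    {c d e : ℝ} {f : ℝ → ℝ} {x u : ℝ} {N : ℕ} (hu : u ∈ Ico (0 : ℝ) 1)
    (h : ∀ n, f^[n + N] x = brokenMap c d e ((contractedRot (rotParam θ))^[n] u)) :
    omegaLim f x = brokenMap c d e '' rotAttractor θ := by
  have hb0 := half_lt_rotParam hθ h0 h1
  have hb1 := rotParam_lt_one hθ h1
  rw [omegaLim_eq_setOf_mapClusterPt_add f x N]
  simp_rw [h]
  refine setOf_mapClusterPt_comp_eq_image (g := brokenMap c d e) (isCompact_Icc.union isCompact_Icc)
    (fun z hz => continuousAt_brokenMap ?_) ?_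
    (fun z => mapClusterPt_contractedRot_iff hθ hu) (rotAttractor_subset hθ h0 h1)
  · rintro rfl
    rcases hz with hz | hz
    · linarith [hz.2]
    · linarith [hz.1]
  -- The starting point u may lie in the gap, but one step of the contracted rotation leaves it for
  -- good.
  · filter_upwards [eventually_ge_atTop 1] with n hn
    obtain ⟨k, rfl⟩ := Nat.exists_eq_add_of_le' hn
    rw [Function.iterate_succ_apply']
    exact contractedRot_mem_union hb0 hb1 (contractedRot_iterate_mem _ hu k)

/-! ### The trapping region of `F_t` -/

/-- The arc `[-1/6, 1/6)` of the circle, seen in `[0, 1)`. -/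
def trappingSet : Set ℝ := {x | x < 1 / 6 ∨ 5 / 6 ≤ x}

/-- The chart `[0, 1) → [-1/6, 1/6)` of the trapping arc. -/
noncomputable def trapChart (u : ℝ) : ℝ := brokenMap (1 / 3) (5 / 6) (-1 / 6) u

theorem exists_trapChart_eq {x : ℝ} (hx : x ∈ Ico (0 : ℝ) 1) (ht : x ∈ trappingSet) :
    ∃ u ∈ Ico (0 : ℝ) 1, trapChart u = x := by
  obtain ⟨h0, h1⟩ := hx
  rcases ht with h | h
  · refine ⟨3 * x + 1 / 2, ⟨by linarith, by linarith⟩, ?_⟩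
    rw [trapChart, brokenMap_of_le (by linarith)]
    ring
  · refine ⟨3 * x - 5 / 2, ⟨by linarith, by linarith⟩, ?_⟩
    rw [trapChart, brokenMap_of_lt (by linarith)]
    ring

theorem trapChart_injOn : InjOn trapChart (Ico 0 1) := by
  rintro u ⟨hu0, hu1⟩ v ⟨hv0, hv1⟩ h
  unfold trapChart brokenMap at h
  split_ifs at h <;> linarith

/-- This is the chart in which the repeller is described, being the F-image of an attractor. -/
theorem discoF_trapChart {u : ℝ} (hu : u ∈ Ico (0 : ℝ) 1) :
    discoF (trapChart u) = brokenMap (2 / 3) (1 / 2) (-1 / 6) u := by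
  obtain ⟨h0, h1⟩ := hu
  unfold trapChart brokenMap discoF
  split_ifs <;> linarith

theorem discoF_mem_trappingSet {x : ℝ} (hx : x ∉ trappingSet) : discoF x ∈ trappingSet := by
  obtain ⟨h0, h1⟩ := not_or.1 (show ¬(x < 1 / 6 ∨ 5 / 6 ≤ x) from hx)
  rw [not_lt] at h0
  rw [not_le] at h1
  rw [discoF, if_neg (not_lt.2 h0)]
  split_ifs with h2
  · exact Or.inl (by linarith)
  · exact Or.inr (by linarith)

theorem discoMap_trapChart {b u : ℝ} (hb0 : 1 / 2 < b) (hb1 : b < 1) (hu : u ∈ Ico (0 : ℝ) 1) :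
    discoMap ((2 * b / 3 : ℝ) : UnitAddCircle) (trapChart u) =
      trapChart (contractedRot b u) := by
  obtain ⟨h0, h1⟩ := hu
  have hr : rot ((2 * b / 3 : ℝ) : UnitAddCircle) (trapChart u) = (u + 2 * b) / 3 - 1 / 6 := by
    rw [rot_eq_fract, Int.fract_eq_iff]
    refine ⟨by linarith, by linarith, ?_⟩
    rcases lt_or_ge u (1 / 2) with h | h
    · refine ⟨1, ?_⟩
      rw [trapChart, brokenMap_of_lt h]
      push_cast
      ring
    · refine ⟨0, ?_⟩
      rw [trapChart, brokenMap_of_le h]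
      push_cast
      ring
  rw [discoMap, hr, discoF, if_neg (by linarith)]
  by_cases h : u / 2 + b < 1
  · rw [if_pos (by linarith), contractedRot, Int.fract_eq_self.2 ⟨by linarith, h⟩, trapChart,
      brokenMap_of_le (by linarith)]
    ring
  · have hf : contractedRot b u = u / 2 + b - 1 :=
      Int.fract_eq_iff.2 ⟨by linarith, by linarith, 1, by push_cast; ring⟩
    rw [if_neg (by linarith), if_pos (by linarith), hf, trapChart, brokenMap_of_lt (by linarith)]
    ring

theorem discoMap_iterate_trapChart {b u : ℝ} (hb0 : 1 / 2 < b) (hb1 : b < 1)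
    (hu : u ∈ Ico (0 : ℝ) 1) (n : ℕ) :
    (discoMap ((2 * b / 3 : ℝ) : UnitAddCircle))^[n] (trapChart u) =
      trapChart ((contractedRot b)^[n] u) := by
  induction n with
  | zero => rfl
  | succ n ih =>
    rw [Function.iterate_succ_apply', Function.iterate_succ_apply', ih,
      discoMap_trapChart hb0 hb1 (contractedRot_iterate_mem b hu n)]

theorem discoMap_iterate_mem (t : UnitAddCircle) {x : ℝ} (hx : x ∈ Ico (0 : ℝ) 1) (n : ℕ) :
    (discoMap t)^[n] x ∈ Ico (0 : ℝ) 1 :=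
  MapsTo.iterate (fun y _ => discoMap_mem t y) n hx

theorem discoMapInv_mem (t : UnitAddCircle) (x : ℝ) : discoMapInv t x ∈ Ico (0 : ℝ) 1 :=
  rot_mem (-t) _

theorem discoMapInv_iterate_mem (t : UnitAddCircle) {x : ℝ} (hx : x ∈ Ico (0 : ℝ) 1) (n : ℕ) :
    (discoMapInv t)^[n] x ∈ Ico (0 : ℝ) 1 :=
  MapsTo.iterate (fun y _ => discoMapInv_mem t y) n hx

/-- `F` conjugates `F_t⁻¹` to `F_{-t}`. -/
theorem discoF_discoMapInv (t : UnitAddCircle) (x : ℝ) :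
    discoF (discoMapInv t x) = discoMap (-t) (discoF x) := rfl

theorem discoF_discoMapInv_iterate (t : UnitAddCircle) (x : ℝ) (n : ℕ) :
    discoF ((discoMapInv t)^[n] x) = (discoMap (-t))^[n] (discoF x) := by
  induction n with
  | zero => rfl
  | succ n ih =>
    rw [Function.iterate_succ_apply', Function.iterate_succ_apply', discoF_discoMapInv, ih]

theorem discoMapInv_iterate_eq (t : UnitAddCircle) {x : ℝ} (hx : x ∈ Ico (0 : ℝ) 1) (n : ℕ) :
    (discoMapInv t)^[n] x = discoF ((discoMap (-t))^[n] (discoF x)) := by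
  rw [← discoF_discoMapInv_iterate, discoF_discoF (discoMapInv_iterate_mem t hx n)]

theorem discoMap_iterate_discoMapInv_iterate (t : UnitAddCircle) {x : ℝ} (hx : x ∈ Ico (0 : ℝ) 1)
    (n : ℕ) : (discoMap t)^[n] ((discoMapInv t)^[n] x) = x := by
  induction n with
  | zero => rfl
  | succ n ih =>
    rw [Function.iterate_succ_apply, Function.iterate_succ_apply' (discoMapInv t),
      discoMap_discoMapInv t (discoMapInv_iterate_mem t hx n), ih]

theorem discoMapInv_iterate_discoMap_iterate (t : UnitAddCircle) {x : ℝ} (hx : x ∈ Ico (0 : ℝ) 1)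
    (n : ℕ) : (discoMapInv t)^[n] ((discoMap t)^[n] x) = x := by
  induction n with
  | zero => rfl
  | succ n ih =>
    rw [Function.iterate_succ_apply, Function.iterate_succ_apply' (discoMap t),
      discoMapInv_discoMap t (discoMap_iterate_mem t hx n), ih]

/-! ### Capture by the trapping arc and its time reversal -/

section Attraction

variable {θ : ℝ}

/-- A point all of whose backward iterates lie in the trapping arc is in the attractor. -/
theorem mem_trapChart_image_of_backward (hθ : Irrational θ) (h0 : 0 < θ) (h1 : θ < 1) {x : ℝ}
    (h : ∀ n, ∃ y ∈ Ico (0 : ℝ) 1 ∩ trappingSet,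
      (discoMap ((2 * rotParam θ / 3 : ℝ) : UnitAddCircle))^[n] y = x) :
    ∃ u ∈ rotAttractor θ, u ∈ Ico (0 : ℝ) 1 ∧ trapChart u = x := by
  have hb0 := half_lt_rotParam hθ h0 h1
  have hb1 := rotParam_lt_one hθ h1
  obtain ⟨y, hy, rfl⟩ := h 0
  obtain ⟨u, hu, rfl⟩ := exists_trapChart_eq hy.1 hy.2
  refine ⟨u, mem_rotAttractor_of_forall_exists_iterate hθ fun n => ?_, hu, rfl⟩
  obtain ⟨z, hz, hzu⟩ := h n
  obtain ⟨v, hv, rfl⟩ := exists_trapChart_eq hz.1 hz.2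
  rw [discoMap_iterate_trapChart hb0 hb1 hv] at hzu
  exact ⟨v, hv, trapChart_injOn (contractedRot_iterate_mem _ hv n) hu hzu⟩

theorem omegaLim_discoMap_of_trapped (hθ : Irrational θ) (h0 : 0 < θ) (h1 : θ < 1) {x : ℝ}
    (hx : x ∈ Ico (0 : ℝ) 1) {N : ℕ}
    (hN : (discoMap ((2 * rotParam θ / 3 : ℝ) : UnitAddCircle))^[N] x ∈ trappingSet) :
    omegaLim (discoMap ((2 * rotParam θ / 3 : ℝ) : UnitAddCircle)) x =
      brokenMap (1 / 3) (5 / 6) (-1 / 6) '' rotAttractor θ := by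
  obtain ⟨u, hu, hux⟩ := exists_trapChart_eq (discoMap_iterate_mem _ hx N) hN
  refine omegaLim_eq_brokenMap_image hθ h0 h1 hu (N := N) fun n => ?_
  rw [Function.iterate_add_apply, ← hux, discoMap_iterate_trapChart (half_lt_rotParam hθ h0 h1)
    (rotParam_lt_one hθ h1) hu]
  rfl

theorem omegaLim_discoMapInv_of_trapped (hθ : Irrational θ) (h0 : 0 < θ) (h1 : θ < 1)
    {t : UnitAddCircle} (ht : -t = ((2 * rotParam θ / 3 : ℝ) : UnitAddCircle)) {x : ℝ}
    (hx : x ∈ Ico (0 : ℝ) 1) {N : ℕ} (hN : discoF ((discoMapInv t)^[N] x) ∈ trappingSet) :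
    omegaLim (discoMapInv t) x = brokenMap (2 / 3) (1 / 2) (-1 / 6) '' rotAttractor θ := by
  obtain ⟨u, hu, hux⟩ := exists_trapChart_eq (discoF_mem (discoMapInv_iterate_mem t hx N)) hN
  refine omegaLim_eq_brokenMap_image hθ h0 h1 hu (N := N) fun n => ?_
  rw [Function.iterate_add_apply, discoMapInv_iterate_eq t (discoMapInv_iterate_mem t hx N), ← hux,
    ht, discoMap_iterate_trapChart (half_lt_rotParam hθ h0 h1) (rotParam_lt_one hθ h1) hu,
    discoF_trapChart (contractedRot_iterate_mem _ hu n)]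

theorem omegaLim_discoMap (hθ : Irrational θ) (h0 : 0 < θ) (h1 : θ < 1) {θ' : ℝ}
    (hθ' : Irrational θ') (h0' : 0 < θ') (h1' : θ' < 1)
    (ht : -((2 * rotParam θ / 3 : ℝ) : UnitAddCircle) = ((2 * rotParam θ' / 3 : ℝ) : UnitAddCircle))
    {x : ℝ} (hx : x ∈ Ico (0 : ℝ) 1)
    (hxR : x ∉ brokenMap (2 / 3) (1 / 2) (-1 / 6) '' rotAttractor θ') :
    omegaLim (discoMap ((2 * rotParam θ / 3 : ℝ) : UnitAddCircle)) x =
      brokenMap (1 / 3) (5 / 6) (-1 / 6) '' rotAttractor θ := by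
  set t := ((2 * rotParam θ / 3 : ℝ) : UnitAddCircle)
  by_contra hne
  refine hxR ?_
  have hout : ∀ N, (discoMap t)^[N] x ∉ trappingSet := fun N hN =>
    hne (omegaLim_discoMap_of_trapped hθ h0 h1 hx hN)
  -- The points F(F_t^n x) lie in the arc and form a backward orbit of F(x) under F_{-t}, so F(x) is
  -- in the attractor for -t.
  obtain ⟨u, huA, hu, hux⟩ := mem_trapChart_image_of_backward hθ' h0' h1' (x := discoF x)
    fun n => ⟨discoF ((discoMap t)^[n] x), ⟨discoF_mem (discoMap_iterate_mem t hx n),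
      discoF_mem_trappingSet (hout n)⟩, by
        rw [← ht, ← discoF_discoMapInv_iterate, discoMapInv_iterate_discoMap_iterate t hx]⟩
  exact ⟨u, huA, by rw [← discoF_trapChart hu, hux, discoF_discoF hx]⟩

theorem omegaLim_discoMapInv (hθ : Irrational θ) (h0 : 0 < θ) (h1 : θ < 1) {θ' : ℝ}
    (hθ' : Irrational θ') (h0' : 0 < θ') (h1' : θ' < 1)
    (ht : -((2 * rotParam θ / 3 : ℝ) : UnitAddCircle) = ((2 * rotParam θ' / 3 : ℝ) : UnitAddCircle))
    {x : ℝ} (hx : x ∈ Ico (0 : ℝ) 1)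
    (hxC : x ∉ brokenMap (1 / 3) (5 / 6) (-1 / 6) '' rotAttractor θ) :
    omegaLim (discoMapInv ((2 * rotParam θ / 3 : ℝ) : UnitAddCircle)) x =
      brokenMap (2 / 3) (1 / 2) (-1 / 6) '' rotAttractor θ' := by
  set t := ((2 * rotParam θ / 3 : ℝ) : UnitAddCircle)
  by_contra hne
  refine hxC ?_
  have hin : ∀ N, (discoMapInv t)^[N] x ∈ trappingSet := fun N => by
    have h : discoF ((discoMapInv t)^[N] x) ∉ trappingSet := fun hN =>
      hne (omegaLim_discoMapInv_of_trapped hθ' h0' h1' ht hx hN)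
    rw [← discoF_discoF (discoMapInv_iterate_mem t hx N)]
    exact discoF_mem_trappingSet h
  obtain ⟨u, huA, -, hux⟩ := mem_trapChart_image_of_backward hθ h0 h1 (x := x)
    fun n => ⟨(discoMapInv t)^[n] x, ⟨discoMapInv_iterate_mem t hx n, hin n⟩,
      discoMap_iterate_discoMapInv_iterate t hx n⟩
  exact ⟨u, huA, hux⟩

end Attraction

/-! ### Dependence of the parameter on the rotation number -/

/-- For irrational x, ⌊-x⌋ = -⌊x⌋ - 1; summing against the weights uses ∑ (k + 1) 2^{-(k+1)} = 2. -/
theorem rotParam_one_sub {θ : ℝ} (hθ : Irrational θ) : rotParam (1 - θ) = 3 / 2 - rotParam θ := by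
  have hg : HasSum (fun k : ℕ => (1 / 2 : ℝ) ^ (k + 1) * ((k : ℝ) + 1)) 2 := by
    have h : HasSum (fun n : ℕ => (n : ℝ) * (1 / 2 : ℝ) ^ n) 2 := by
      have := hasSum_coe_mul_geometric_of_norm_lt_one (𝕜 := ℝ) (r := 1 / 2) (by norm_num)
      norm_num at this ⊢
      exact this
    have h' := (hasSum_nat_add_iff' 1).2 h
    simp only [Finset.range_one, Finset.sum_singleton, Nat.cast_zero, zero_mul, sub_zero] at h'
    refine h'.congr_fun fun k => ?_
    push_cast
    ring
  have hs : floorSeries (1 - θ) 0 = -2 - floorSeries θ 0 - 1 := by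
    have h := (hg.neg.sub (summable_floorSeries θ 0).hasSum).sub hasSum_half_pow_succ
    rw [floorSeries, floorSeries, ← h.tsum_eq]
    congr 1 with k
    have hfl : ⌊(0 : ℝ) - (k + 1) * (1 - θ)⌋ = -(k + 1) - ⌊(0 : ℝ) - (k + 1) * θ⌋ - 1 := by
      rw [Int.floor_eq_iff]
      have h1 := Int.floor_le ((0 : ℝ) - (k + 1) * θ)
      have h2 := Int.lt_floor_add_one ((0 : ℝ) - (k + 1) * θ)
      have hne : (0 : ℝ) - (k + 1) * θ ≠ ⌊0 - ((k : ℝ) + 1) * θ⌋ := fun h =>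
        hθ.mul_succ_ne_int k (-⌊0 - ((k : ℝ) + 1) * θ⌋) (by push_cast; linarith)
      have h3 := lt_of_le_of_ne h1 hne.symm
      push_cast
      constructor <;> linarith
    rw [hfl]
    push_cast
    ring
  rw [rotParam, rotParam, hs]
  ring

theorem neg_coe_rotParam {θ : ℝ} (hθ : Irrational θ) :
    -((2 * rotParam θ / 3 : ℝ) : UnitAddCircle) =
      ((2 * rotParam (1 - θ) / 3 : ℝ) : UnitAddCircle) := by
  rw [rotParam_one_sub hθ, show 2 * (3 / 2 - rotParam θ) / 3 = 1 + -(2 * rotParam θ / 3) by ring,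
    AddCircle.coe_add, AddCircle.coe_period, zero_add, AddCircle.coe_neg]

theorem rotParam_strictMono : StrictMono rotParam := by
  intro θ θ' h
  have hlt : floorSeries θ' 0 < floorSeries θ 0 := by
    -- For such k the arguments of the k-th floors differ by more than 1, so this term is strictly
    -- monotone whether or not θ is irrational.
    obtain ⟨k, hk⟩ := exists_nat_gt (1 / (θ' - θ))
    have hk' : 1 < ((k : ℝ) + 1) * (θ' - θ) := by
      rw [div_lt_iff₀ (sub_pos.2 h)] at hk
      linarith
    refine Summable.tsum_lt_tsum (i := k) (fun j => ?_) ?_ (summable_floorSeries θ' 0)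
      (summable_floorSeries θ 0)
    · have h1 : ((j : ℝ) + 1) * θ ≤ (j + 1) * θ' := by gcongr
      have : ⌊0 - ((j : ℝ) + 1) * θ'⌋ ≤ ⌊0 - ((j : ℝ) + 1) * θ⌋ :=
        Int.floor_le_floor (by linarith)
      have : (⌊0 - ((j : ℝ) + 1) * θ'⌋ : ℝ) ≤ ⌊0 - ((j : ℝ) + 1) * θ⌋ := by exact_mod_cast this
      gcongr
    · have : ⌊0 - ((k : ℝ) + 1) * θ'⌋ + 1 ≤ ⌊0 - ((k : ℝ) + 1) * θ⌋ := by
        rw [← Int.floor_add_one]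
        exact Int.floor_le_floor (by linarith)
      have : (⌊0 - ((k : ℝ) + 1) * θ'⌋ : ℝ) < ⌊0 - ((k : ℝ) + 1) * θ⌋ := by
        exact_mod_cast Int.lt_iff_add_one_le.2 this
      gcongr
  unfold rotParam
  linarith

/-- At irrational θ every floor in the series is locally constant, and on (0, 1) the terms are
dominated by the summable (k + 1) 2^{-(k+1)}. -/
theorem continuousOn_rotParam : ContinuousOn rotParam {θ | Irrational θ ∧ θ ∈ Ioo (0 : ℝ) 1} := by
  refine (ContinuousOn.neg ?_).div_const 2
  refine continuousOn_tsum (fun k => ?_) summable_half_pow_mul_succ fun k θ hθ => ?_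
  · rintro θ ⟨hθ, -⟩
    have hne : (0 : ℝ) - (k + 1) * θ ≠ ⌊0 - ((k : ℝ) + 1) * θ⌋ := fun h =>
      hθ.mul_succ_ne_int k (-⌊0 - ((k : ℝ) + 1) * θ⌋) (by push_cast; linarith)
    have h2 : ∀ᶠ w in 𝓝 (0 - ((k : ℝ) + 1) * θ), ⌊w⌋ = ⌊0 - ((k : ℝ) + 1) * θ⌋ := by
      filter_upwards [Ioo_mem_nhds (lt_of_le_of_ne (Int.floor_le _) hne.symm)
        (Int.lt_floor_add_one _)] with w hw
      exact Int.floor_eq_iff.2 ⟨hw.1.le, hw.2⟩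
    have hc : Continuous fun θ : ℝ => 0 - ((k : ℝ) + 1) * θ := by fun_prop
    refine ContinuousAt.continuousWithinAt (ContinuousAt.congr continuousAt_const
      (f := fun _ => (1 / 2 : ℝ) ^ (k + 1) * (⌊0 - ((k : ℝ) + 1) * θ⌋ : ℝ)) ?_)
    filter_upwards [(hc.tendsto θ).eventually h2] with θ' h'
    rw [h']
  · obtain ⟨-, h0, h1⟩ := hθ
    rw [norm_mul, Real.norm_eq_abs, Real.norm_eq_abs,
      abs_of_pos (by positivity : (0 : ℝ) < (1 / 2) ^ (k + 1))]
    have h2 : -((k : ℤ) + 1) ≤ ⌊0 - ((k : ℝ) + 1) * θ⌋ := Int.le_floor.2 (by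
      push_cast
      nlinarith [(Nat.cast_nonneg k : (0 : ℝ) ≤ k)])
    have h3 : ⌊0 - ((k : ℝ) + 1) * θ⌋ ≤ 0 := by
      rw [← Int.cast_le (R := ℝ)]
      refine (Int.floor_le _).trans ?_
      have : 0 ≤ ((k : ℝ) + 1) * θ := by positivity
      push_cast
      linarith
    have h2' : -((k : ℝ) + 1) ≤ (⌊0 - ((k : ℝ) + 1) * θ⌋ : ℝ) := by exact_mod_cast h2
    have h3' : (⌊0 - ((k : ℝ) + 1) * θ⌋ : ℝ) ≤ 0 := by exact_mod_cast h3
    refine mul_le_mul_of_nonneg_left (abs_le.2 ⟨h2', ?_⟩) (by positivity)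
    linarith [(Nat.cast_nonneg k : (0 : ℝ) ≤ k)]

/-! ### A Cantor set of parameters -/

/-- A compact set of irrational numbers of `(0, 1)` with positive measure. -/
theorem exists_isCompact_irrational_pos_volume :
    ∃ Θ : Set ℝ, IsCompact Θ ∧ Θ ⊆ {θ | Irrational θ ∧ θ ∈ Ioo (0 : ℝ) 1} ∧ 0 < volume Θ := by
  have hc : (range ((↑) : ℚ → ℝ)).Countable := countable_range _
  have hm : MeasurableSet (Ioo (0 : ℝ) 1 \ range ((↑) : ℚ → ℝ)) :=
    measurableSet_Ioo.diff hc.measurableSet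
  have hv : 0 < volume (Ioo (0 : ℝ) 1 \ range ((↑) : ℚ → ℝ)) := by
    rw [measure_sdiff_null (hc.measure_zero volume), Real.volume_Ioo]
    simp
  obtain ⟨Θ, hsub, hcpt, hpos⟩ := hm.exists_lt_isCompact hv
  exact ⟨Θ, hcpt, fun θ hθ => ⟨(hsub hθ).2, (hsub hθ).1⟩, hpos⟩

theorem isTotallyDisconnected_of_irrational {A : Set ℝ} (hA : ∀ x ∈ A, Irrational x) :
    IsTotallyDisconnected A := by
  intro T hT hpre x hx y hy
  by_contra hne
  wlog h : x < y generalizing x y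
  · exact this hy hx (Ne.symm hne) (lt_of_le_of_ne (not_lt.1 h) (Ne.symm hne))
  obtain ⟨q, hq1, hq2⟩ := exists_rat_btwn h
  exact hA q (hT (hpre.Icc_subset hx hy ⟨hq1.le, hq2.le⟩)) ⟨q, rfl⟩

/-- Cantor–Bendixson gives a perfect subset of the uncountable compact image; a continuous injection
of a compact set is an embedding, so total disconnectedness carries over. -/
theorem exists_isCantorSet_subset_image {X : Type*} [TopologicalSpace X] [T2Space X]
    [SecondCountableTopology X] {Θ : Set ℝ} (hΘ : IsCompact Θ) (hd : IsTotallyDisconnected Θ)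
    (hu : ¬Θ.Countable) {p : ℝ → X} (hp : ContinuousOn p Θ) (hi : InjOn p Θ) :
    ∃ K : Set X, IsCantorSet K ∧ K ⊆ p '' Θ := by
  have hcpt := hΘ.image_of_continuousOn hp
  obtain ⟨K, hK, hne, hsub⟩ := exists_perfect_nonempty_of_isClosed_of_not_countable hcpt.isClosed
    fun h => hu (countable_of_injective_of_countable_image hi h)
  refine ⟨K, ⟨hne, hcpt.of_isClosed_subset hK.closed hsub, hK, ?_⟩, hsub⟩
  have : CompactSpace Θ := isCompact_iff_compactSpace.1 hΘ
  have : TotallyDisconnectedSpace Θ := totallyDisconnectedSpace_subtype_iff.2 hd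
  have he : IsEmbedding (Θ.domRestrict p) :=
    ((continuousOn_iff_continuous_domRestrict.1 hp).isClosedEmbedding
      (injOn_iff_injective.1 hi)).isEmbedding
  have ht := he.isTotallyDisconnected_range.2 this
  rw [range_domRestrict] at ht
  exact fun T hT => ht T (hT.trans hsub)

theorem exists_isCantorSet_parameters : ∃ K : Set UnitAddCircle, IsCantorSet K ∧ ∀ t ∈ K,
    ∃ θ, Irrational θ ∧ 0 < θ ∧ θ < 1 ∧ t = ((2 * rotParam θ / 3 : ℝ) : UnitAddCircle) := by
  obtain ⟨Θ, hΘ, hsub, hpos⟩ := exists_isCompact_irrational_pos_volume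
  obtain ⟨K, hK, hKsub⟩ := exists_isCantorSet_subset_image (X := UnitAddCircle)
    (p := fun θ => ((2 * rotParam θ / 3 : ℝ) : UnitAddCircle)) hΘ
    (isTotallyDisconnected_of_irrational fun θ hθ => (hsub hθ).1)
    (fun h => hpos.ne' (h.measure_zero volume))
    ((AddCircle.continuous_mk' 1).comp_continuousOn
      (((continuousOn_rotParam.mono hsub).const_mul 2).div_const 3)) (by
      intro θ hθ θ' hθ' h
      -- As 1/2 < b < 1, the number 2b/3 stays in (1/3, 2/3), so passing to the circle loses no
      -- injectivity.
      have hI : ∀ θ ∈ Θ, 2 * rotParam θ / 3 ∈ Ico (0 : ℝ) (0 + 1) := fun θ hθ => by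
        obtain ⟨hi, h0, h1⟩ := hsub hθ
        have := half_lt_rotParam hi h0 h1
        have := rotParam_lt_one hi h1
        constructor <;> linarith
      have h' := (AddCircle.coe_eq_coe_iff_of_mem_Ico (hI θ hθ) (hI θ' hθ')).1 h
      exact rotParam_strictMono.injective (by linarith))
  refine ⟨K, hK, fun t ht => ?_⟩
  obtain ⟨θ, hθ, rfl⟩ := hKsub ht
  exact ⟨θ, (hsub hθ).1, (hsub hθ).2.1, (hsub hθ).2.2, rfl⟩

theorem exists_isCantorSet_attractor_repeller {θ : ℝ} (hθ : Irrational θ) (h0 : 0 < θ)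
    (h1 : θ < 1) {t : UnitAddCircle} (ht : t = ((2 * rotParam θ / 3 : ℝ) : UnitAddCircle)) :
    ∃ C R : Set ℝ,
      C ⊆ Ico (0 : ℝ) 1 ∧ IsCantorSet C ∧
      volume C = 0 ∧ (∀ s : ℝ, 0 < s → μH[s] C = 0) ∧
      R ⊆ Ico (0 : ℝ) 1 ∧ IsCantorSet R ∧ volume R = 0 ∧
      Disjoint C R ∧
      (∀ x ∈ Ico (0 : ℝ) 1 \ R, omegaLim (discoMap t) x = C) ∧
      (∀ x ∈ Ico (0 : ℝ) 1 \ C, omegaLim (discoMapInv t) x = R) := by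
  subst ht
  have hθ' : Irrational (1 - θ) := by simpa using hθ.natCast_sub 1
  have h0' : 0 < 1 - θ := by linarith
  have h1' : 1 - θ < 1 := by linarith
  have hneg := neg_coe_rotParam hθ
  have hhalf : ∀ θ, Irrational θ → 0 < θ → θ < 1 → ∀ u ∈ rotAttractor θ,
      u ∈ Icc (0 : ℝ) 1 ∧ u ≠ 1 / 2 := fun θ hθ h0 h1 u hu => by
    have hb0 := half_lt_rotParam hθ h0 h1
    have hb1 := rotParam_lt_one hθ h1
    rcases rotAttractor_subset hθ h0 h1 hu with h | h
    · exact ⟨⟨h.1, by linarith [h.2]⟩, by linarith [h.2]⟩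
    · exact ⟨⟨by linarith [h.1], h.2⟩, by linarith [h.1]⟩
  have hC : ∀ x ∈ brokenMap (1 / 3) (5 / 6) (-1 / 6) '' rotAttractor θ,
      x ∈ Ioc (0 : ℝ) (1 / 6) ∪ Ico (5 / 6) 1 := by
    rintro _ ⟨u, hu, rfl⟩
    obtain ⟨⟨hu0, hu1⟩, hne⟩ := hhalf θ hθ h0 h1 u hu
    rcases hne.lt_or_gt with h | h
    · rw [brokenMap_of_lt h]
      exact Or.inr ⟨by linarith, by linarith⟩
    · rw [brokenMap_of_le h.le]
      exact Or.inl ⟨by linarith, by linarith⟩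
  have hR : ∀ x ∈ brokenMap (2 / 3) (1 / 2) (-1 / 6) '' rotAttractor (1 - θ),
      x ∈ Ioo (1 / 6 : ℝ) (5 / 6) := by
    rintro _ ⟨u, hu, rfl⟩
    obtain ⟨⟨hu0, hu1⟩, hne⟩ := hhalf _ hθ' h0' h1' u hu
    rcases hne.lt_or_gt with h | h
    · rw [brokenMap_of_lt h]
      constructor <;> linarith
    · rw [brokenMap_of_le h.le]
      constructor <;> linarith
  have hH : ∀ θ, Irrational θ → ∀ c d e s : ℝ, 0 < s →
      μH[s] (brokenMap c d e '' rotAttractor θ) = 0 := fun θ hθ c d e s hs =>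
    hausdorffMeasure_brokenMap_image hs.le (hausdorffMeasure_rotAttractor hθ hs)
  have hV : ∀ θ, Irrational θ → ∀ c d e : ℝ,
      volume (brokenMap c d e '' rotAttractor θ) = 0 := fun θ hθ c d e => by
    rw [← hausdorffMeasure_real]
    exact hH θ hθ c d e 1 one_pos
  have hK : ∀ θ, Irrational θ → 0 < θ → θ < 1 → ∀ c d e : ℝ, c ≠ 0 →
      IsCantorSet (brokenMap c d e '' rotAttractor θ) := fun θ hθ h0 h1 c d e hc =>
    isCantorSet_brokenMap_image hc rotAttractor_nonempty (isCompact_rotAttractor hθ h0 h1)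
      (perfect_rotAttractor hθ).acc (fun h => (hhalf θ hθ h0 h1 _ h).2 rfl)
      (hausdorffMeasure_rotAttractor hθ one_pos)
  refine ⟨brokenMap (1 / 3) (5 / 6) (-1 / 6) '' rotAttractor θ,
    brokenMap (2 / 3) (1 / 2) (-1 / 6) '' rotAttractor (1 - θ), ?_, hK θ hθ h0 h1 _ _ _ (by norm_num),
    hV θ hθ _ _ _, hH θ hθ _ _ _, ?_, hK _ hθ' h0' h1' _ _ _ (by norm_num), hV _ hθ' _ _ _,
    ?_, ?_, ?_⟩
  · intro x hx
    rcases hC x hx with h | h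
    · exact ⟨h.1.le, by linarith [h.2]⟩
    · exact ⟨by linarith [h.1], h.2⟩
  · intro x hx
    have := hR x hx
    exact ⟨by linarith [this.1], by linarith [this.2]⟩
  · rw [Set.disjoint_left]
    intro x hx hx'
    have := hR x hx'
    rcases hC x hx with h | h
    · linarith [h.2, this.1]
    · linarith [h.1, this.2]
  · exact fun x hx => omegaLim_discoMap hθ h0 h1 hθ' h0' h1' hneg hx.1 hx.2
  · exact fun x hx => omegaLim_discoMapInv hθ h0 h1 hθ' h0' h1' hneg hx.1 hx.2

/-! ### Completely periodic parameters -/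

theorem exists_rat_discoF_eq (y : ℝ) : ∃ c d : ℚ, 0 < c ∧ discoF y = c * y + d := by
  unfold discoF
  split_ifs
  · exact ⟨2, 1 / 6, by norm_num, by push_cast; ring⟩
  · exact ⟨1 / 2, -1 / 12, by norm_num, by push_cast; ring⟩
  · exact ⟨1 / 2, 7 / 12, by norm_num, by push_cast; ring⟩
  · exact ⟨2, -7 / 6, by norm_num, by push_cast; ring⟩

theorem exists_rat_discoMap_iterate_succ_zero (s : ℝ) (p : ℕ) :
    ∃ α β : ℚ, 0 < α ∧ (discoMap (s : UnitAddCircle))^[p + 1] 0 = α * s + β := by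
  -- The translation adds 1 to the coefficient of s before a positive slope multiplies it, so the
  -- coefficient is positive from the first iterate on.
  have step : ∀ (α β : ℚ), 0 ≤ α → ∃ α' β' : ℚ, 0 < α' ∧
      discoMap (s : UnitAddCircle) (α * s + β) = α' * s + β' := fun α β hα => by
    obtain ⟨c, d, hc, h⟩ := exists_rat_discoF_eq (rot (s : UnitAddCircle) (α * s + β))
    refine ⟨c * (α + 1), c * (β - ⌊α * s + β + s⌋) + d, by positivity, ?_⟩
    rw [discoMap, h, rot_eq_fract, Int.fract]
    push_cast
    ring
  induction p with
  | zero => simpa using step 0 0 le_rfl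
  | succ p ih =>
    obtain ⟨α, β, hα, h⟩ := ih
    rw [Function.iterate_succ_apply', h]
    exact step α β hα.le

theorem countable_completelyPeriodic : {t : UnitAddCircle | ∃ p : ℕ, 0 < p ∧
    ∀ x ∈ Ico (0 : ℝ) 1, (discoMap t)^[p] x = x}.Countable := by
  refine (countable_range fun q : ℚ => ((q : ℝ) : UnitAddCircle)).mono ?_
  rintro t ⟨p, hp, h⟩
  obtain ⟨s, rfl⟩ := QuotientAddGroup.mk_surjective t
  obtain ⟨k, rfl⟩ := Nat.exists_eq_add_of_le' hp
  obtain ⟨α, β, hα, he⟩ := exists_rat_discoMap_iterate_succ_zero s k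
  have h0 := h 0 ⟨le_rfl, one_pos⟩
  have hα' : (α : ℝ) ≠ 0 := by exact_mod_cast hα.ne'
  refine ⟨-β / α, ?_⟩
  have : s = ((-β / α : ℚ) : ℝ) := by
    push_cast
    rw [eq_div_iff hα']
    have : (α : ℝ) * s + β = 0 := he.symm.trans h0
    linarith
  rw [this]

/-! ### Periodic parameters from strips -/

section Strips

variable {f : ℝ → ℝ} {a w : ℝ} {k : ℕ}

theorem iterate_of_translates
    (hf : ∀ x, a ≤ x → x < a + (k * w - w) → f x = x + w) {r : ℝ} (hr : r ∈ Ico 0 w) (i : ℕ)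
    (hi : i < k) : f^[i] (a + r) = a + r + i * w := by
  induction i with
  | zero => simp
  | succ i ih =>
    have hw : 0 < w := hr.1.trans_lt hr.2
    have h1 : (0 : ℝ) ≤ i * w := by positivity
    have h2 : ((i : ℝ) + 1 + 1) * w ≤ k * w := by
      gcongr
      exact_mod_cast hi
    rw [Function.iterate_succ_apply', ih (by omega), hf _ (by linarith [hr.1]) (by linarith [hr.2])]
    push_cast
    ring

theorem iterate_strip (hk : 0 < k)
    (hf : ∀ x, a ≤ x → x < a + (k * w - w) → f x = x + w) {r : ℝ} (hr : r ∈ Ico 0 w) :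
    f^[k] (a + r) = f (a + r + (k * w - w)) := by
  obtain ⟨j, rfl⟩ := Nat.exists_eq_add_of_le' hk
  rw [Function.iterate_succ_apply', iterate_of_translates hf hr j (by omega)]
  congr 1
  push_cast
  ring

/-- Every point of the k strips is an iterate of a point of the base strip, and periodicity passes
along orbits. -/
theorem iterate_eq_self_of_strip (hw : 0 < w)
    (hf : ∀ x, a ≤ x → x < a + (k * w - w) → f x = x + w) {m : ℕ}
    (hr : ∀ r ∈ Ico 0 w, f^[m] (a + r) = a + r) {x : ℝ} (hx : x ∈ Ico a (a + k * w)) :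
    f^[m] x = x := by
  set i := ⌊(x - a) / w⌋₊
  have h0 : 0 ≤ (x - a) / w := div_nonneg (sub_nonneg.2 hx.1) hw.le
  have h1 : (i : ℝ) * w ≤ x - a := (le_div_iff₀ hw).1 (Nat.floor_le h0)
  have h2 : x - a < (i + 1) * w := (div_lt_iff₀ hw).1 (Nat.lt_floor_add_one _)
  have hi : i < k := (Nat.floor_lt h0).2 ((div_lt_iff₀ hw).2 (by linarith [hx.2]))
  have hmem : x - a - i * w ∈ Ico 0 w := ⟨by linarith, by linarith⟩
  have hxi : x = f^[i] (a + (x - a - i * w)) := by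
    rw [iterate_of_translates hf hmem i hi]
    ring
  rw [hxi, ← Function.iterate_add_apply, add_comm, Function.iterate_add_apply, hr _ hmem]

end Strips

section Periodic

variable {h x : ℝ}

theorem discoMap_coe_of_lt_one (h0 : 0 ≤ x + h) (h1 : x + h < 1) :
    discoMap (h : UnitAddCircle) x = discoF (x + h) := by
  rw [discoMap, rot_eq_fract, Int.fract_eq_self.2 ⟨h0, h1⟩]

theorem discoMap_coe_A (h0 : 0 ≤ x + h) (h1 : x + h < 1 / 6) :
    discoMap (h : UnitAddCircle) x = 2 * (x + h) + 1 / 6 := by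
  rw [discoMap_coe_of_lt_one h0 (by linarith), discoF, if_pos h1]

theorem discoMap_coe_B (h0 : 1 / 6 ≤ x + h) (h1 : x + h < 1 / 2) :
    discoMap (h : UnitAddCircle) x = (x + h - 1 / 6) / 2 := by
  rw [discoMap_coe_of_lt_one (by linarith) (by linarith), discoF, if_neg (by linarith), if_pos h1]

theorem discoMap_coe_C (h0 : 1 / 2 ≤ x + h) (h1 : x + h < 5 / 6) :
    discoMap (h : UnitAddCircle) x = (x + h - 1 / 2) / 2 + 5 / 6 := by
  rw [discoMap_coe_of_lt_one (by linarith) (by linarith), discoF, if_neg (by linarith),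
    if_neg (by linarith), if_pos h1]

theorem discoMap_coe_D (h0 : 5 / 6 ≤ x + h) (h1 : x + h < 1) :
    discoMap (h : UnitAddCircle) x = 2 * (x + h - 5 / 6) + 1 / 2 := by
  rw [discoMap_coe_of_lt_one (by linarith) (by linarith), discoF, if_neg (by linarith),
    if_neg (by linarith), if_neg (by linarith)]

theorem discoMap_coe_wrap (h0 : 1 ≤ x + h) (h1 : x + h < 7 / 6) :
    discoMap (h : UnitAddCircle) x = 2 * (x + h - 1) + 1 / 6 := by
  have : Int.fract (x + h) = x + h - 1 :=
    Int.fract_eq_iff.2 ⟨by linarith, by linarith, 1, by push_cast; ring⟩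
  rw [discoMap, rot_eq_fract, this, discoF, if_pos (by linarith)]

/-- Each of the four branch intervals splits into k strips, of width 3h/2 or 3h, which g = F_t²
translates one to the next. Thus g^k maps the four base strips among themselves. The low parts
follow the cycle A → D → C → B → A and the high parts the reverse cycle; in both the affine maps
compose to the identity, so g^{4k} = F_t^{8k} is the identity. -/
theorem discoMap_iterate_eq_self {k : ℕ} (hk : 0 < k) (hh : 9 * (k * h) = 1)
    (hx : x ∈ Ico (0 : ℝ) 1) : (discoMap (h : UnitAddCircle))^[2 * (k * 4)] x = x := by
  have hk1 : (1 : ℝ) ≤ k := by exact_mod_cast hk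
  have hpos : 0 < h := by
    by_contra! hn
    nlinarith
  have hle : h ≤ 1 / 9 := by nlinarith
  set f := discoMap (h : UnitAddCircle) with hf
  set g := f^[2] with hg
  have hg2 : ∀ x, g x = f (f x) := fun x => rfl
  have mA : ∀ x, 0 ≤ x → x < 0 + (k * (3 * h / 2) - 3 * h / 2) → g x = x + 3 * h / 2 :=
    fun x h0 h1 => by
      rw [hg2, hf, discoMap_coe_A (x := x), discoMap_coe_B] <;> linarith
  have mB : ∀ x, 1 / 6 ≤ x → x < 1 / 6 + (k * (3 * h) - 3 * h) → g x = x + 3 * h :=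
    fun x h0 h1 => by
      rw [hg2, hf, discoMap_coe_B (x := x), discoMap_coe_A] <;> linarith
  have mC : ∀ x, 1 / 2 ≤ x → x < 1 / 2 + (k * (3 * h) - 3 * h) → g x = x + 3 * h :=
    fun x h0 h1 => by
      rw [hg2, hf, discoMap_coe_C (x := x), discoMap_coe_D] <;> linarith
  have mD : ∀ x, 5 / 6 ≤ x → x < 5 / 6 + (k * (3 * h / 2) - 3 * h / 2) → g x = x + 3 * h / 2 :=
    fun x h0 h1 => by
      rw [hg2, hf, discoMap_coe_D (x := x), discoMap_coe_C] <;> linarith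
  have lowA : ∀ r, 0 ≤ r → r < h / 2 → g^[k] (0 + r) = 5 / 6 + r := fun r h0 h1 => by
    rw [iterate_strip hk mA ⟨h0, by linarith⟩, hg2, hf,
      discoMap_coe_A (x := _ + r + _), discoMap_coe_C] <;> linarith
  have highA : ∀ r, h / 2 ≤ r → r < 3 * h / 2 → g^[k] (0 + r) = 1 / 6 + (r + 3 * h / 2) :=
    fun r h0 h1 => by
      rw [iterate_strip hk mA ⟨by linarith, h1⟩, hg2, hf,
        discoMap_coe_B (x := _ + r + _), discoMap_coe_A] <;> linarith
  have lowB : ∀ r, 0 ≤ r → r < 2 * h → g^[k] (1 / 6 + r) = 0 + r / 4 := fun r h0 h1 => by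
    rw [iterate_strip hk mB ⟨h0, by linarith⟩, hg2, hf,
      discoMap_coe_B (x := _ + r + _), discoMap_coe_B] <;> linarith
  have highB : ∀ r, 2 * h ≤ r → r < 3 * h → g^[k] (1 / 6 + r) = 1 / 2 + r := fun r h0 h1 => by
    rw [iterate_strip hk mB ⟨by linarith, h1⟩, hg2, hf,
      discoMap_coe_C (x := _ + r + _), discoMap_coe_D] <;> linarith
  have lowC : ∀ r, 0 ≤ r → r < 2 * h → g^[k] (1 / 2 + r) = 1 / 6 + r := fun r h0 h1 => by
    rw [iterate_strip hk mC ⟨h0, by linarith⟩, hg2, hf,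
      discoMap_coe_C (x := _ + r + _), discoMap_coe_wrap] <;>
      linarith
  have highC : ∀ r, 2 * h ≤ r → r < 3 * h → g^[k] (1 / 2 + r) = 5 / 6 + (r - 3 * h / 2) :=
    fun r h0 h1 => by
      rw [iterate_strip hk mC ⟨by linarith, h1⟩, hg2, hf,
        discoMap_coe_D (x := _ + r + _), discoMap_coe_C] <;> linarith
  have lowD : ∀ r, 0 ≤ r → r < h / 2 → g^[k] (5 / 6 + r) = 1 / 2 + 4 * r := fun r h0 h1 => by
    rw [iterate_strip hk mD ⟨h0, by linarith⟩, hg2, hf,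
      discoMap_coe_D (x := _ + r + _), discoMap_coe_D] <;> linarith
  have highD : ∀ r, h / 2 ≤ r → r < 3 * h / 2 → g^[k] (5 / 6 + r) = 0 + r := fun r h0 h1 => by
    rw [iterate_strip hk mD ⟨by linarith, h1⟩, hg2, hf,
      discoMap_coe_wrap (x := _ + r + _), discoMap_coe_B] <;>
      linarith
  have four : ∀ x, g^[k * 4] x = g^[k] (g^[k] (g^[k] (g^[k] x))) := fun x => by
    rw [Function.iterate_mul]
    rfl
  rw [Function.iterate_mul, ← hg]
  obtain ⟨hx0, hx1⟩ := hx
  rcases lt_or_ge x (1 / 6) with c1 | c1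
  · refine iterate_eq_self_of_strip (by linarith) mA (fun r hr => ?_) ⟨hx0, by linarith⟩
    rw [four]
    rcases lt_or_ge r (h / 2) with c | c
    · rw [lowA r hr.1 c, lowD r hr.1 c, lowC _ (by linarith [hr.1]) (by linarith),
        lowB _ (by linarith [hr.1]) (by linarith)]
      ring
    · rw [highA r c hr.2, highB _ (by linarith) (by linarith [hr.2]), highC _ (by linarith)
        (by linarith [hr.2]), highD _ (by linarith) (by linarith [hr.2])]
      ring
  rcases lt_or_ge x (1 / 2) with c2 | c2
  · refine iterate_eq_self_of_strip (by linarith) mB (fun r hr => ?_) ⟨c1, by linarith⟩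
    rw [four]
    rcases lt_or_ge r (2 * h) with c | c
    · rw [lowB r hr.1 c, lowA _ (by linarith [hr.1]) (by linarith), lowD _ (by linarith [hr.1])
        (by linarith), lowC _ (by linarith [hr.1]) (by linarith)]
      ring
    · rw [highB r c hr.2, highC r c hr.2, highD _ (by linarith) (by linarith [hr.2]), highA _ (by linarith)
        (by linarith [hr.2])]
      ring
  rcases lt_or_ge x (5 / 6) with c3 | c3
  · refine iterate_eq_self_of_strip (by linarith) mC (fun r hr => ?_) ⟨c2, by linarith⟩
    rw [four]
    rcases lt_or_ge r (2 * h) with c | c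
    · rw [lowC r hr.1 c, lowB r hr.1 c, lowA _ (by linarith [hr.1]) (by linarith), lowD _
        (by linarith [hr.1]) (by linarith)]
      ring
    · rw [highC r c hr.2, highD _ (by linarith) (by linarith [hr.2]), highA _ (by linarith)
        (by linarith [hr.2]), highB _ (by linarith) (by linarith [hr.2])]
      ring
  · refine iterate_eq_self_of_strip (by linarith) mD (fun r hr => ?_) ⟨c3, by linarith⟩
    rw [four]
    rcases lt_or_ge r (h / 2) with c | c
    · rw [lowD r hr.1 c, lowC _ (by linarith [hr.1]) (by linarith), lowB _ (by linarith [hr.1])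
        (by linarith), lowA _ (by linarith [hr.1]) (by linarith)]
      ring
    · rw [highD r c hr.2, highA r c hr.2, highB _ (by linarith) (by linarith [hr.2]), highC _ (by linarith)
        (by linarith [hr.2])]
      ring

end Periodic

theorem infinite_completelyPeriodic : {t : UnitAddCircle | ∃ p : ℕ, 0 < p ∧
    ∀ x ∈ Ico (0 : ℝ) 1, (discoMap t)^[p] x = x}.Infinite := by
  have hinj : Function.Injective fun k : ℕ => ((1 / (9 * ((k : ℝ) + 1)) : ℝ) : UnitAddCircle) := by
    intro k l hkl
    have hI : ∀ k : ℕ, 1 / (9 * ((k : ℝ) + 1)) ∈ Ico (0 : ℝ) (0 + 1) := fun k => by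
      refine ⟨by positivity, ?_⟩
      rw [zero_add, div_lt_one (by positivity)]
      linarith [(Nat.cast_nonneg k : (0 : ℝ) ≤ k)]
    have := (AddCircle.coe_eq_coe_iff_of_mem_Ico (hI k) (hI l)).1 hkl
    have hk : (9 * ((k : ℝ) + 1)) ≠ 0 := by positivity
    have hl : (9 * ((l : ℝ) + 1)) ≠ 0 := by positivity
    rw [div_eq_div_iff hk hl] at this
    exact_mod_cast (by linarith : (k : ℝ) = l)
  refine (infinite_range_of_injective hinj).mono ?_
  rintro _ ⟨k, rfl⟩
  refine ⟨2 * ((k + 1) * 4), by positivity, fun x hx => ?_⟩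
  refine discoMap_iterate_eq_self (Nat.succ_pos k) ?_ hx
  push_cast
  field_simp

/-! ### Conclusion -/

theorem theorem2 :
    (∃ K : Set UnitAddCircle, IsCantorSet K ∧ ∀ t ∈ K,
      ∃ C R : Set ℝ,
        C ⊆ Ico (0 : ℝ) 1 ∧ IsCantorSet C ∧
        volume C = 0 ∧ (∀ s : ℝ, 0 < s → μH[s] C = 0) ∧
        R ⊆ Ico (0 : ℝ) 1 ∧ IsCantorSet R ∧ volume R = 0 ∧
        Disjoint C R ∧
        (∀ x ∈ Ico (0 : ℝ) 1 \ R, omegaLim (discoMap t) x = C) ∧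
        (∀ x ∈ Ico (0 : ℝ) 1 \ C, omegaLim (discoMapInv t) x = R)) ∧
    {t : UnitAddCircle | ∃ p : ℕ, 0 < p ∧
      ∀ x ∈ Ico (0 : ℝ) 1, (discoMap t)^[p] x = x}.Countable ∧
    {t : UnitAddCircle | ∃ p : ℕ, 0 < p ∧
      ∀ x ∈ Ico (0 : ℝ) 1, (discoMap t)^[p] x = x}.Infinite := by
  refine ⟨?_, countable_completelyPeriodic, infinite_completelyPeriodic⟩
  obtain ⟨K, hK, h⟩ := exists_isCantorSet_parameters
  refine ⟨K, hK, fun t ht => ?_⟩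
  obtain ⟨θ, hθ, h0, h1, rfl⟩ := h t ht
  exact exists_isCantorSet_attractor_repeller hθ h0 h1 rfl
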